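/- Let $\{u\}$ denote the fractional part of $u$, let $\alpha(x)=\{1/x\}$ for $0<x\le 1$, and let $\alpha_0(x)=x$, $\alpha_{k+1}(x)=\alpha(\alpha_k(x))$ as long as $\alpha_k(x)\neq 0$. For $x\in[0,1]$ define the Brjuno function $$\Phi(x)=\sum_{k}\alpha_0(x)\alpha_1(x)\cdots\alpha_{k-1}(x)\log\bigl(1/\alpha_k(x)\bigr)\in[0,+\infty],$$ where the sum is over all $k\ge 0$ if $x$ is irrational, and over $0\le k<K$ if $x$ is rational, $K$ being the first index with $\alpha_K(x)=0$ (so $\Phi(0)=\Phi(1)=0$ and $\Phi$ is finite at rational points). An irrational $x\in\,]0,1[$ with $\Phi(x)=+\infty$ is called a Cremer number. **Theorem.** The function $\Phi$ is integrable on $[0,1]$; for $0\le x\le 1$ put $\Psi(x)=\int_0^x\Phi(t)\,dt$. Then: (i) for every irrational $x_0\in\,]0,1[$, $$\Psi(x_0+h)-\Psi(x_0)=o\bigl(h\log(1/|h|)\bigr)\qquad(h\to0,\ h\neq 0);$$ (ii) for every irrational $x_0\in\,]0,1[$, $$\frac{\Psi(x_0+h)-\Psi(x_0)}{h}\longrightarrow\Phi(x_0)\qquad(h\to0,\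 h\neq0),$$ the limit being $+\infty$ if $x_0$ is a Cremer number; (iii) there is an absolute constant $C$ such that for every rational $x_0=p/q\in[0,1]$ in lowest terms (with $p\ge 0$, $q\ge 1$), and every real $h$ with $0<|h|<\frac{2}{3q^2}$ and $x_0+h\in[0,1]$, $$\left|\Psi(x_0+h)-\Psi(x_0)-\frac1q\,h\log\frac1{|h|}-\Bigl(\frac1q-2\,\frac{\log q}{q}+\Phi(x_0)\Bigr)h\right|\le C\,q\,h^2\log\bigl((q^2|h|)^{-1}\bigr).$$ -/

import Mathlib

open Set Filter Topology MeasureTheory Asymptotics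
open scoped ENNReal

noncomputable section

namespace Brjuno

/-- The Gauss map `x ↦ {1/x}`, continued by `0 ↦ 0` so that it can be iterated along the finite
orbits of rational numbers. -/
def gauss (x : ℝ) : ℝ := if x = 0 then 0 else Int.fract (1 / x)

/-- The iterates `α_k` of the Gauss map, with `α_0 x = x`. -/
def alpha (k : ℕ) (x : ℝ) : ℝ := gauss^[k] x

/-- The term `γ_k(x) = α_0(x) ⋯ α_{k-1}(x) log (1 / α_k(x))`, and `0` when `α_k(x) = 0`,
that is, when the continued fraction of `x` has already stopped. -/
def gammaTerm (k : ℕ) (x : ℝ) : ℝ :=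
  if alpha k x = 0 then 0 else (∏ j ∈ Finset.range k, alpha j x) * Real.log (1 / alpha k x)

/-- The Brjuno function `Φ : [0,1] → [0,∞]`. At an irrational point it is the full series
with nonnegative terms; at a rational point it is the finite sum over the indices `k` smaller than
the length of the continued fraction (see `Phi_eq_sum` below); `Φ(0) = Φ(1) = 0`. It is only used
on `[0,1]`. -/
def Phi (x : ℝ) : ℝ≥0∞ := ∑' k : ℕ, ENNReal.ofReal (gammaTerm k x)

/-- `Ψ(x) = ∫_0^x Φ(t) dt` for `0 ≤ x ≤ 1`, as a real number (the integral is that of a function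
with values in `[0,∞]`). -/
def Psi (x : ℝ) : ℝ := (∫⁻ t in Icc 0 x, Phi t).toReal

lemma alpha_succ (k : ℕ) (x : ℝ) : alpha (k + 1) x = gauss (alpha k x) :=
  Function.iterate_succ_apply' gauss k x

lemma alpha_eq_zero_of_le {K k : ℕ} {x : ℝ} (h : alpha K x = 0) (hk : K ≤ k) :
    alpha k x = 0 := by
  induction k, hk using Nat.le_induction with
  | base => exact h
  | succ n _ ih => simp [alpha_succ, ih, gauss]

/-- If the continued fraction of `x` stops at `K`, then `Φ(x)` is the finite sum over `k < K`. -/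
lemma Phi_eq_sum {K : ℕ} {x : ℝ} (h : alpha K x = 0) :
    Phi x = ∑ k ∈ Finset.range K, ENNReal.ofReal (gammaTerm k x) := by
  refine tsum_eq_sum fun k hk => ?_
  have : alpha k x = 0 := alpha_eq_zero_of_le h (by simpa using hk)
  simp [gammaTerm, this]

/-- The orbit of a rational number under the Gauss map reaches `0`. -/
lemma exists_alpha_eq_zero (p q : ℕ) : ∃ K, alpha K ((p : ℝ) / q) = 0 := by
  induction p using Nat.strong_induction_on generalizing q with
  | _ p ih =>
    rcases Nat.eq_zero_or_pos p with rfl | hp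
    · exact ⟨0, by simp [alpha]⟩
    rcases Nat.eq_zero_or_pos q with rfl | hq
    · exact ⟨0, by simp [alpha]⟩
    obtain ⟨K, hK⟩ := ih (q % p) (Nat.mod_lt _ hp) p
    refine ⟨K + 1, ?_⟩
    have hne : ((p : ℝ) / q) ≠ 0 := by positivity
    have hg : gauss ((p : ℝ) / q) = ((q % p : ℕ) : ℝ) / p := by
      rw [gauss, if_neg hne, one_div_div, Int.fract_div_natCast_eq_div_natCast_mod]
    simpa [alpha, Function.iterate_succ_apply, hg] using hK

/-- `Φ` is finite at rational numbers. -/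
lemma Phi_rat_ne_top (p q : ℕ) : Phi ((p : ℝ) / q) ≠ ∞ := by
  obtain ⟨K, hK⟩ := exists_alpha_eq_zero p q
  rw [Phi_eq_sum hK]
  exact ENNReal.sum_ne_top.2 fun _ _ => ENNReal.ofReal_ne_top

end Brjuno

end

noncomputable section

namespace Brjuno

/-! Everything rests on the functional equation Φ(x) = log(1/x) + x Φ({1/x}) (`Phi_eq`), that is Φ =
log(1/x) + TΦ with Tf(x) = x f({1/x}). In L¹ with the Gauss weight 1/(1+t) the operator T contracts
by 2/3 (`lintegral_weight_transfer_le`), so Φ is integrable. Summing only over the branches near 0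
gives ∫₀ˢ TΦ = O(s²) (`lintegral_transfer_Phi_le`), so Ψ(s) = s log(1/s) + s + O(s²).

Parts (i) and (ii) follow from a maximal inequality (`wBound_head`, `wBound_Phi`): the mean of Φ
between an irrational y₀ and y is at most a constant times 2 + y₀ plus the Brjuno sum at y₀ with its
logarithms capped at log(1/|y - y₀|). It is proved by following both points under the Gauss map.
While they share a branch, the weights in `WBound` make the pullback lossless, the constant being
multiplied by y₀ exactly. When they separate, either the interval is long and the O(s²) bound
suffices, or an integer falls between 1/y₀ and 1/y; Φ then has a logarithmic peak there, and the
closeness of y₀ to that peak already shows as a large term of Φ(y₀). For (i), the capped sum is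
o(log(1/|h|)) because the products β_k are summable. For (ii), the lower bound is continuity of the
partial sums at irrationals; the upper bound is the local maximal inequality for the tails
(`eventually_wBound_tail`), whose right side tends to 0 when Φ(x₀) is finite.

For (iii), iterating the functional equation along the Euclidean algorithm shows that in the chart x
= (p + s p')/(q + s q') of determinant ±1, Φ(x) = Φ(p/q) + (Φ(s) + O(|s|))/(q + s q'), with Φ
extended periodically (`exists_localModel`). The constant is uniform since the errors are summed
along remainders that decay geometrically. Integrating in s and inserting the expansion of Ψ near 0
gives the estimate. -/

/-! ### Gauss map, partial sums and tails, functional equation -/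

lemma gauss_nonneg (x : ℝ) : 0 ≤ gauss x := by
  unfold gauss; split_ifs <;> [exact le_rfl; exact Int.fract_nonneg _]

lemma gauss_lt_one (x : ℝ) : gauss x < 1 := by
  unfold gauss; split_ifs <;> [exact one_pos; exact Int.fract_lt_one _]

lemma gauss_of_ne_zero {x : ℝ} (hx : x ≠ 0) : gauss x = Int.fract (1 / x) := if_neg hx

lemma measurable_gauss : Measurable gauss :=
  Measurable.ite (measurableSet_singleton 0) measurable_const
    (measurable_fract.comp (measurable_const.div measurable_id))

lemma alpha_zero (x : ℝ) : alpha 0 x = x := rfl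

lemma alpha_succ' (k : ℕ) (x : ℝ) : alpha (k + 1) x = alpha k (gauss x) :=
  Function.iterate_succ_apply gauss k x

lemma measurable_alpha (k : ℕ) : Measurable (alpha k) := measurable_gauss.iterate k

lemma alpha_nonneg {x : ℝ} (hx : 0 ≤ x) (k : ℕ) : 0 ≤ alpha k x := by
  cases k with
  | zero => exact hx
  | succ k => rw [alpha_succ]; exact gauss_nonneg _

lemma alpha_le_one {x : ℝ} (hx : x ≤ 1) (k : ℕ) : alpha k x ≤ 1 := by
  cases k with
  | zero => exact hx
  | succ k => rw [alpha_succ]; exact (gauss_lt_one _).le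

/-- The product `α_0(x) ⋯ α_{k-1}(x)`. -/
def beta (k : ℕ) (x : ℝ) : ℝ := ∏ j ∈ Finset.range k, alpha j x

lemma beta_zero (x : ℝ) : beta 0 x = 1 := rfl

lemma beta_succ (k : ℕ) (x : ℝ) : beta (k + 1) x = x * beta k (gauss x) := by
  simp only [beta, Finset.prod_range_succ', alpha_succ', alpha_zero]
  rw [mul_comm]

lemma beta_nonneg {x : ℝ} (hx : 0 ≤ x) (k : ℕ) : 0 ≤ beta k x :=
  Finset.prod_nonneg fun j _ => alpha_nonneg hx j

lemma measurable_gammaTerm (k : ℕ) : Measurable (gammaTerm k) := by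
  refine Measurable.ite ((measurable_alpha k) (measurableSet_singleton 0)) measurable_const ?_
  exact (Finset.measurable_prod _ fun j _ => measurable_alpha j).mul
    (Real.measurable_log.comp (measurable_const.div (measurable_alpha k)))

lemma measurable_Phi : Measurable Phi :=
  Measurable.tsum fun k => (measurable_gammaTerm k).ennreal_ofReal

lemma gammaTerm_zero (x : ℝ) : gammaTerm 0 x = Real.log (1 / x) := by
  by_cases hx : x = 0 <;> simp [gammaTerm, alpha_zero, hx]

lemma gammaTerm_succ (k : ℕ) (x : ℝ) : gammaTerm (k + 1) x = x * gammaTerm k (gauss x) := by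
  unfold gammaTerm
  rw [alpha_succ']
  split_ifs
  · simp
  · rw [← mul_assoc]; exact congrArg (· * _) (beta_succ k x)

lemma gammaTerm_eq (k : ℕ) (x : ℝ) : gammaTerm k x = beta k x * Real.log (1 / alpha k x) := by
  unfold gammaTerm
  split_ifs with h
  · simp [h]
  · rfl

lemma gammaTerm_nonneg {x : ℝ} (h0 : 0 ≤ x) (h1 : x ≤ 1) (k : ℕ) : 0 ≤ gammaTerm k x := by
  rw [gammaTerm_eq, one_div, Real.log_inv]
  exact mul_nonneg (beta_nonneg h0 k)
    (neg_nonneg.2 (Real.log_nonpos (alpha_nonneg h0 k) (alpha_le_one h1 k)))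

/-- The transfer `f ↦ (t ↦ t f({1/t}))`. -/
def transfer (f : ℝ → ℝ≥0∞) (t : ℝ) : ℝ≥0∞ := ENNReal.ofReal t * f (gauss t)

lemma measurable_transfer {f : ℝ → ℝ≥0∞} (hf : Measurable f) : Measurable (transfer f) :=
  ENNReal.measurable_ofReal.mul (hf.comp measurable_gauss)

/-- The tail `∑_{k ≥ K} γ_k`. -/
def tail (K : ℕ) (x : ℝ) : ℝ≥0∞ := ∑' k : ℕ, ENNReal.ofReal (gammaTerm (k + K) x)

/-- The partial sum `∑_{k < K} γ_k`. -/
def head (K : ℕ) (x : ℝ) : ℝ≥0∞ := ∑ k ∈ Finset.range K, ENNReal.ofReal (gammaTerm k x)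

lemma measurable_tail (K : ℕ) : Measurable (tail K) :=
  Measurable.tsum fun _ => (measurable_gammaTerm _).ennreal_ofReal

lemma measurable_head (K : ℕ) : Measurable (head K) :=
  Finset.measurable_sum _ fun k _ => (measurable_gammaTerm k).ennreal_ofReal

lemma tail_zero : tail 0 = Phi := rfl

lemma Phi_eq_head_add_tail (K : ℕ) (x : ℝ) : Phi x = head K x + tail K x :=
  (ENNReal.summable.sum_add_tsum_nat_add' (f := fun k => ENNReal.ofReal (gammaTerm k x))).symm

lemma head_le_Phi (K : ℕ) (x : ℝ) : head K x ≤ Phi x := ENNReal.sum_le_tsum _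

lemma tail_succ {x : ℝ} (hx : 0 ≤ x) (K : ℕ) : tail (K + 1) x = transfer (tail K) x := by
  simp only [tail, transfer, ← ENNReal.tsum_mul_left, ← add_assoc, gammaTerm_succ,
    ENNReal.ofReal_mul hx]

lemma head_succ {x : ℝ} (hx : 0 ≤ x) (K : ℕ) :
    head (K + 1) x = ENNReal.ofReal (Real.log (1 / x)) + transfer (head K) x := by
  simp only [head, transfer, Finset.sum_range_succ', gammaTerm_succ, ENNReal.ofReal_mul hx,
    gammaTerm_zero, Finset.mul_sum]
  rw [add_comm]

lemma Phi_eq {x : ℝ} (hx : 0 ≤ x) :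
    Phi x = ENNReal.ofReal (Real.log (1 / x)) + transfer Phi x := by
  rw [Phi_eq_head_add_tail 1, tail_succ hx, tail_zero]
  simp [head, gammaTerm_zero]

/-- Since x {1/x} = 1 - n x with n ≥ 1. Thus 2 + x is a supersolution of B(x) = 1 + x B({1/x}), the
recursion of ∑ β_k; the same inequality closes the induction of the maximal inequality. -/
lemma one_add_mul_gauss_le {x : ℝ} (h0 : 0 ≤ x) (h1 : x ≤ 1) :
    1 + x * (2 + gauss x) ≤ 2 + x := by
  rcases h0.eq_or_lt with rfl | h0
  · simp
  rw [gauss_of_ne_zero h0.ne', Int.fract, mul_add, mul_sub, mul_one_div_cancel h0.ne']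
  have hn : (1 : ℝ) ≤ ⌊1 / x⌋ := by
    exact_mod_cast Int.le_floor.2 (by rw [le_div_iff₀ h0]; simpa using h1)
  nlinarith

lemma sum_beta_le (K : ℕ) {x : ℝ} (h0 : 0 ≤ x) (h1 : x ≤ 1) :
    ∑ k ∈ Finset.range K, beta k x ≤ 2 + x := by
  induction K generalizing x with
  | zero => simp; linarith
  | succ K ih =>
    simp only [Finset.sum_range_succ', beta_succ, beta_zero, ← Finset.mul_sum]
    have := ih (gauss_nonneg x) (gauss_lt_one x).le
    nlinarith [one_add_mul_gauss_le h0 h1, mul_le_mul_of_nonneg_left this h0]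

lemma summable_beta {x : ℝ} (h0 : 0 ≤ x) (h1 : x ≤ 1) : Summable fun k => beta k x :=
  summable_of_sum_range_le (fun k => beta_nonneg h0 k) fun K => sum_beta_le K h0 h1

lemma gauss_irrational {x : ℝ} (hx : Irrational x) : Irrational (gauss x) := by
  rw [gauss_of_ne_zero hx.ne_zero, Int.fract, one_div]
  exact (irrational_inv_iff.2 hx).sub_intCast _

lemma gauss_mem_Ioo {x : ℝ} (hx : Irrational x) : gauss x ∈ Ioo (0 : ℝ) 1 :=
  ⟨(gauss_nonneg x).lt_of_ne' (gauss_irrational hx).ne_zero, gauss_lt_one x⟩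

lemma alpha_irrational {x : ℝ} (hx : Irrational x) (k : ℕ) : Irrational (alpha k x) := by
  induction k with
  | zero => exact hx
  | succ k ih => rw [alpha_succ]; exact gauss_irrational ih

/-- The periodic extension of `Φ`. -/
def Per (x : ℝ) : ℝ≥0∞ := Phi (Int.fract x)

lemma measurable_Per : Measurable Per := measurable_Phi.comp measurable_fract

lemma Phi_zero : Phi 0 = 0 := by
  rw [Phi_eq_sum (K := 0) (by rfl)]; simp

lemma Phi_one : Phi 1 = 0 := by
  rw [Phi_eq zero_le_one]
  simp [transfer, gauss, Phi_zero]

lemma Per_eq_Phi {x : ℝ} (hx : x ∈ Icc (0 : ℝ) 1) : Per x = Phi x := by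
  rcases hx.2.eq_or_lt with rfl | h
  · simp [Per, Phi_one, Phi_zero]
  · rw [Per, Int.fract_eq_self.2 ⟨hx.1, h⟩]

lemma Per_add_natCast (n : ℕ) (x : ℝ) : Per (n + x) = Per x := by
  rw [Per, Int.fract_natCast_add, Per]

lemma Per_of_pos {x : ℝ} (hx : 0 < x) (h1 : x ≤ 1) :
    Per x = ENNReal.ofReal (Real.log (1 / x)) + ENNReal.ofReal x * Per (1 / x) := by
  rw [Per_eq_Phi ⟨hx.le, h1⟩, Phi_eq hx.le, transfer, gauss_of_ne_zero hx.ne', Per]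

/-! ### Change of variables along the branches, integrability of Φ -/

lemma lintegral_image_inv_add (m : ℝ) {A : Set ℝ} (hA : MeasurableSet A)
    (hpos : ∀ w ∈ A, 0 < m + w) (G : ℝ → ℝ≥0∞) :
    ∫⁻ t in (fun w => 1 / (m + w)) '' A, G t
      = ∫⁻ w in A, ENNReal.ofReal (((m + w) ^ 2)⁻¹) * G (1 / (m + w)) := by
  rw [lintegral_image_eq_lintegral_abs_deriv_mul hA (f' := fun w => -((m + w) ^ 2)⁻¹)]
  · simp only [abs_neg]
    refine setLIntegral_congr_fun hA fun w _ => ?_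
    simp only [abs_of_nonneg (inv_nonneg.2 (sq_nonneg (m + w)))]
  · intro w hw
    refine HasDerivAt.hasDerivWithinAt ?_
    have := ((hasDerivAt_id w).const_add m).inv (hpos w hw).ne'
    exact (this.congr_deriv (by simp [div_eq_mul_inv])).congr_of_eventuallyEq
      (Eventually.of_forall fun x => by simp)
  · intro a ha b hb hab
    have ha' := (hpos a ha).ne'
    have hb' := (hpos b hb).ne'
    simp only at hab
    field_simp at hab
    linarith

lemma Ioc_subset_iUnion_image (N : ℕ) (hN : 1 ≤ N) :
    Ioc (0 : ℝ) (1 / N) ⊆ ⋃ n : ℕ, (fun w : ℝ => 1 / (((N + n : ℕ) : ℝ) + w)) '' Ico 0 1 := by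
  intro t ht
  have hN' : (0 : ℝ) < N := by exact_mod_cast hN
  have h1 : (N : ℝ) ≤ 1 / t := by
    rw [le_div_iff₀ ht.1]; have := ht.2; rw [le_div_iff₀ hN'] at this; linarith
  have h2 : N ≤ ⌊1 / t⌋₊ := Nat.le_floor h1
  refine mem_iUnion.2 ⟨⌊1 / t⌋₊ - N, 1 / t - ⌊1 / t⌋₊, ⟨?_, ?_⟩, ?_⟩
  · have := Nat.floor_le (le_trans hN'.le h1); linarith
  · have := Nat.lt_floor_add_one (1 / t); linarith
  · simp only [Nat.add_sub_cancel' h2]; simp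

lemma setLIntegral_Ioc_le_tsum (N : ℕ) (hN : 1 ≤ N) (G : ℝ → ℝ≥0∞) :
    ∫⁻ t in Ioc (0 : ℝ) (1 / N), G t ≤ ∑' n : ℕ, ∫⁻ w in Ico (0 : ℝ) 1,
      ENNReal.ofReal (((((N + n : ℕ) : ℝ) + w) ^ 2)⁻¹) * G (1 / (((N + n : ℕ) : ℝ) + w)) := by
  refine (lintegral_mono_set (Ioc_subset_iUnion_image N hN)).trans
    ((lintegral_iUnion_le _ _).trans ?_)
  refine ENNReal.tsum_le_tsum fun n => (lintegral_image_inv_add _ measurableSet_Ico ?_ _).le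
  intro w hw
  have : (1 : ℝ) ≤ ((N + n : ℕ) : ℝ) := by exact_mod_cast (by omega)
  linarith [hw.1]

lemma gauss_inv_natCast_add {n : ℕ} (hn : 1 ≤ n) {w : ℝ} (hw : w ∈ Ico (0 : ℝ) 1) :
    gauss (1 / (n + w)) = w := by
  have : (1 : ℝ) ≤ n := by exact_mod_cast hn
  rw [gauss_of_ne_zero (by have := hw.1; positivity), one_div_one_div, Int.fract_natCast_add,
    Int.fract_eq_self.2 hw]

/-- Integration of a transferred function against a weight. -/
lemma setLIntegral_transfer_le (N : ℕ) (hN : 1 ≤ N) {f : ℝ → ℝ≥0∞} (hf : Measurable f)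
    {g : ℝ → ℝ} (hg : Measurable g) (hg0 : ∀ t, 0 ≤ t → 0 ≤ g t) :
    ∫⁻ t in Ioc (0 : ℝ) (1 / N), ENNReal.ofReal (g t) * transfer f t ≤
      ∫⁻ w in Ico (0 : ℝ) 1, (∑' n : ℕ, ENNReal.ofReal
        (((((N + n : ℕ) : ℝ) + w) ^ 3)⁻¹ * g (1 / (((N + n : ℕ) : ℝ) + w)))) * f w := by
  refine (setLIntegral_Ioc_le_tsum N hN _).trans_eq ?_
  simp only [← ENNReal.tsum_mul_right]
  rw [lintegral_tsum]
  · refine tsum_congr fun n => setLIntegral_congr_fun measurableSet_Ico fun w hw => ?_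
    have h1 : (1 : ℝ) ≤ ((N + n : ℕ) : ℝ) := by exact_mod_cast (by omega)
    have h2 : (0 : ℝ) < ((N + n : ℕ) : ℝ) + w := by linarith [hw.1]
    simp only [transfer]
    rw [gauss_inv_natCast_add (by omega) hw, ← mul_assoc, ← mul_assoc,
      ← ENNReal.ofReal_mul (by positivity),
      ← ENNReal.ofReal_mul (mul_nonneg (by positivity) (hg0 _ (by positivity)))]
    congr 2
    field_simp
  · intro n
    refine (Measurable.mul (Measurable.ennreal_ofReal ?_) hf).aemeasurable
    exact ((measurable_id.const_add _).pow_const _).inv.mul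
      (hg.comp (measurable_const.div (measurable_id.const_add _)))

lemma tsum_ofReal_le_of_telescope {a H : ℕ → ℝ} (h : ∀ n, a n ≤ H n - H (n + 1))
    (ha : ∀ n, 0 ≤ a n) (hH : ∀ n, 0 ≤ H n) : ∑' n, ENNReal.ofReal (a n) ≤ ENNReal.ofReal (H 0) := by
  refine ENNReal.tsum_le_of_sum_range_le fun n => ?_
  rw [← ENNReal.ofReal_sum_of_nonneg fun i _ => ha i]
  refine ENNReal.ofReal_le_ofReal ((Finset.sum_le_sum fun i _ => h i).trans ?_)
  rw [Finset.sum_range_sub']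
  linarith [hH n]

/-- The Gauss density makes the sum over branches explicit: branch z = 1 + n + w contributes
1/(z²(z+1)), and the total is compared with 2/3 of the weight at w. -/
lemma lintegral_weight_transfer_le {f : ℝ → ℝ≥0∞} (hf : Measurable f) :
    ∫⁻ t in Ioc (0 : ℝ) 1, ENNReal.ofReal (1 / (1 + t)) * transfer f t ≤
      ENNReal.ofReal (2 / 3) * ∫⁻ t in Ioc (0 : ℝ) 1, ENNReal.ofReal (1 / (1 + t)) * f t := by
  have := setLIntegral_transfer_le 1 le_rfl hf (g := fun t => 1 / (1 + t))
    (measurable_const.div (measurable_id.const_add _)) (fun t ht => by positivity)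
  rw [Nat.cast_one, div_one] at this
  refine this.trans ?_
  rw [← lintegral_const_mul' _ _ ENNReal.ofReal_ne_top, ← setLIntegral_congr Ico_ae_eq_Ioc]
  refine setLIntegral_mono' measurableSet_Ico fun w hw => ?_
  rw [← mul_assoc, ← ENNReal.ofReal_mul (by norm_num)]
  gcongr
  have hw0 := hw.1
  -- The comparison 1/(z²(z+1)) ≤ (2/3)(z⁻² - (z+1)⁻²) amounts to z ≥ 1, with equality there; this
  -- is the origin of 2/3.
  refine (tsum_ofReal_le_of_telescope (H := fun n => (2 / 3) / (1 + n + w) ^ 2) ?_ ?_ ?_).trans ?_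
  · intro n
    push_cast
    have hz : (1 : ℝ) ≤ 1 + n + w := by have : (0 : ℝ) ≤ n := n.cast_nonneg; linarith
    have e : 1 + ((n : ℝ) + 1) + w = (1 + n + w) + 1 := by ring
    rw [e]
    generalize 1 + (n : ℝ) + w = z at hz
    have hz0 : 0 < z := by linarith
    have e2 : (z ^ 3)⁻¹ * (1 / (1 + 1 / z)) = 1 / (z ^ 2 * (z + 1)) := by field_simp
    have e3 : 2 / 3 / z ^ 2 - 2 / 3 / (z + 1) ^ 2
        = (2 * (2 * z + 1) / (3 * (z + 1))) * (1 / (z ^ 2 * (z + 1))) := by field_simp; ring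
    rw [e2, e3]
    refine le_mul_of_one_le_left (by positivity) ?_
    rw [le_div_iff₀ (by positivity)]; linarith
  · intro n; push_cast; positivity
  · intro n; positivity
  · refine ENNReal.ofReal_le_ofReal ?_
    simp only [Nat.cast_zero, add_zero]
    rw [div_le_iff₀ (by positivity)]
    have : 2 / 3 * (1 / (1 + w)) * (1 + w) ^ 2 = 2 / 3 * (1 + w) := by field_simp
    rw [this]; linarith

/-- `∫_a^b log (1/t) dt`. -/
lemma lintegral_log_inv {a b : ℝ} (ha : 0 ≤ a) (hab : a ≤ b) (hb : b ≤ 1) :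
    ∫⁻ t in Ioo a b, ENNReal.ofReal (Real.log (1 / t))
      = ENNReal.ofReal (b - a - b * Real.log b + a * Real.log a) := by
  have hint : IntervalIntegrable (fun t => Real.log (1 / t)) volume a b := by
    simp only [one_div, Real.log_inv]
    exact intervalIntegral.intervalIntegrable_log'.neg
  rw [setLIntegral_congr Ioo_ae_eq_Ioc, ← ofReal_integral_eq_lintegral_ofReal
    ((intervalIntegrable_iff_integrableOn_Ioc_of_le hab).1 hint),
    ← intervalIntegral.integral_of_le hab]
  · simp only [one_div, Real.log_inv, intervalIntegral.integral_neg, integral_log]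
    congr 1; ring
  · refine (ae_restrict_mem measurableSet_Ioc).mono fun t ht => ?_
    refine Real.log_nonneg ?_
    have : 0 < t := ha.trans_lt ht.1
    rw [le_div_iff₀ this]; linarith [ht.2]

/-- The bound 3 is the fixed point of A ↦ 1 + (2/3) A, where 1 = ∫₀¹ log(1/t) dt. -/
lemma lintegral_head_le (K : ℕ) :
    ∫⁻ t in Ioc (0 : ℝ) 1, ENNReal.ofReal (1 / (1 + t)) * head K t ≤ ENNReal.ofReal 3 := by
  induction K with
  | zero => simp [head]
  | succ K ih =>
    have h1 : ∫⁻ t in Ioc (0 : ℝ) 1, ENNReal.ofReal (1 / (1 + t)) * head (K + 1) t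
        = (∫⁻ t in Ioc (0 : ℝ) 1, ENNReal.ofReal (1 / (1 + t)) * ENNReal.ofReal (Real.log (1 / t)))
          + ∫⁻ t in Ioc (0 : ℝ) 1, ENNReal.ofReal (1 / (1 + t)) * transfer (head K) t := by
      rw [← lintegral_add_right]
      · refine setLIntegral_congr_fun measurableSet_Ioc fun t ht => ?_
        simp only [head_succ ht.1.le, mul_add]
      · exact (measurable_const.div (measurable_id.const_add _)).ennreal_ofReal.mul
          (measurable_transfer (measurable_head K))
    have h2 : (∫⁻ t in Ioc (0 : ℝ) 1,
        ENNReal.ofReal (1 / (1 + t)) * ENNReal.ofReal (Real.log (1 / t))) ≤ ENNReal.ofReal 1 := by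
      refine le_trans (setLIntegral_mono' measurableSet_Ioc (g := fun t =>
        ENNReal.ofReal (Real.log (1 / t))) fun t ht => ?_) ?_
      · refine mul_le_of_le_one_left zero_le (ENNReal.ofReal_le_one.2 ?_)
        rw [div_le_one (by linarith [ht.1])]; linarith [ht.1]
      · rw [← setLIntegral_congr Ioo_ae_eq_Ioc, lintegral_log_inv le_rfl zero_le_one le_rfl]
        simp
    rw [h1]
    refine (add_le_add h2 ((lintegral_weight_transfer_le (measurable_head K)).trans
      (mul_le_mul_right ih _))).trans_eq ?_
    rw [← ENNReal.ofReal_mul (by norm_num), ← ENNReal.ofReal_add (by norm_num) (by norm_num)]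
    norm_num

lemma tendsto_head (x : ℝ) : Tendsto (fun K => head K x) atTop (𝓝 (Phi x)) :=
  ENNReal.tendsto_nat_tsum _

lemma head_mono (x : ℝ) : Monotone fun K => head K x := fun _ _ h =>
  Finset.sum_le_sum_of_subset (Finset.range_mono h)

lemma iSup_head (x : ℝ) : ⨆ K, head K x = Phi x :=
  (ENNReal.tsum_eq_iSup_nat).symm

/-- Monotone convergence for the partial sums of `Φ` against a weight. -/
lemma lintegral_mul_Phi_le {s : Set ℝ} {g : ℝ → ℝ≥0∞} (hg : Measurable g) {A : ℝ≥0∞}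
    (h : ∀ K, ∫⁻ t in s, g t * head K t ≤ A) : ∫⁻ t in s, g t * Phi t ≤ A := by
  simp only [← iSup_head, ENNReal.mul_iSup]
  rw [lintegral_iSup (f := fun K t => g t * head K t) (fun K => hg.mul (measurable_head K))
    fun _ _ hij x => mul_le_mul_right (head_mono x hij) _]
  exact iSup_le h

lemma lintegral_Phi_Ioc_le : ∫⁻ t in Ioc (0 : ℝ) 1, Phi t ≤ ENNReal.ofReal 6 := by
  have h := lintegral_mul_Phi_le (s := Ioc (0 : ℝ) 1) (g := fun t => ENNReal.ofReal (1 / (1 + t)))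
    (measurable_const.div (measurable_id.const_add _)).ennreal_ofReal lintegral_head_le
  have h2 : ∫⁻ t in Ioc (0 : ℝ) 1, Phi t ≤ ENNReal.ofReal 2 *
      ∫⁻ t in Ioc (0 : ℝ) 1, ENNReal.ofReal (1 / (1 + t)) * Phi t := by
    rw [← lintegral_const_mul' _ _ ENNReal.ofReal_ne_top]
    refine setLIntegral_mono' measurableSet_Ioc fun t ht => ?_
    rw [← mul_assoc, ← ENNReal.ofReal_mul (by norm_num)]
    refine le_mul_of_one_le_left zero_le (ENNReal.one_le_ofReal.2 ?_)
    rw [mul_one_div, le_div_iff₀ (by linarith [ht.1])]; linarith [ht.2]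
  refine h2.trans ((mul_le_mul_right h _).trans_eq ?_)
  rw [← ENNReal.ofReal_mul (by norm_num)]; norm_num

/-- `∫_0^s t Φ({1/t}) dt = O(s²)`. -/
lemma lintegral_transfer_Phi_le {s : ℝ} (h0 : 0 < s) (h1 : s ≤ 1) :
    ∫⁻ t in Ioc (0 : ℝ) s, transfer Phi t ≤ ENNReal.ofReal (32 * s ^ 2) := by
  set N := ⌊1 / s⌋₊ with hNdef
  have hs1 : 1 ≤ 1 / s := by rw [le_div_iff₀ h0]; linarith
  have hN : 1 ≤ N := Nat.le_floor (by exact_mod_cast hs1)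
  have hN' : (1 : ℝ) ≤ N := by exact_mod_cast hN
  have hNs : (N : ℝ) ≤ 1 / s := Nat.floor_le (by positivity)
  have hlt : 1 / s < N + 1 := Nat.lt_floor_add_one _
  have hsub : Ioc (0 : ℝ) s ⊆ Ioc 0 (1 / N) := by
    refine Ioc_subset_Ioc_right ?_
    rw [le_div_iff₀ (by positivity)]; rw [le_div_iff₀ h0] at hNs; linarith
  refine (lintegral_mono_set hsub).trans ?_
  have := setLIntegral_transfer_le N hN measurable_Phi (g := fun _ => 1) measurable_const
    (fun _ _ => zero_le_one)
  simp only [ENNReal.ofReal_one, one_mul, mul_one] at this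
  refine this.trans ?_
  have key : ∫⁻ w in Ico (0 : ℝ) 1, (∑' n : ℕ, ENNReal.ofReal
        (((((N + n : ℕ) : ℝ) + w) ^ 3)⁻¹)) * Phi w ≤
      ∫⁻ w in Ico (0 : ℝ) 1, ENNReal.ofReal (4 / 3 / N ^ 2) * Phi w := by
    refine setLIntegral_mono' measurableSet_Ico fun w hw => ?_
    have hw0 := hw.1
    gcongr
    -- Here z⁻³ ≤ (4/3)(z⁻² - (z+1)⁻²) reduces to 5z² - 2z - 3 ≥ 0, true for z ≥ 1.
    refine (tsum_ofReal_le_of_telescope (H := fun n => (4 / 3) / (N + n + w) ^ 2) ?_ ?_ ?_).trans ?_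
    · intro n
      push_cast
      have hz : (1 : ℝ) ≤ N + n + w := by have : (0 : ℝ) ≤ n := n.cast_nonneg; linarith
      have e : (N : ℝ) + ((n : ℝ) + 1) + w = (N + n + w) + 1 := by ring
      rw [e]
      generalize (N : ℝ) + (n : ℝ) + w = z at hz
      have hz0 : 0 < z := by linarith
      have e3 : 4 / 3 / z ^ 2 - 4 / 3 / (z + 1) ^ 2
        = (4 * (2 * z + 1) * z / (3 * (z + 1) ^ 2)) * (z ^ 3)⁻¹ := by field_simp; ring
      rw [e3]
      refine le_mul_of_one_le_left (by positivity) ?_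
      rw [le_div_iff₀ (by positivity)]; nlinarith
    · intro n; push_cast; positivity
    · intro n; positivity
    · refine ENNReal.ofReal_le_ofReal ?_
      simp only [Nat.cast_zero, add_zero]
      gcongr
      linarith
  refine key.trans ?_
  rw [lintegral_const_mul' _ _ ENNReal.ofReal_ne_top, setLIntegral_congr Ico_ae_eq_Ioc]
  refine (mul_le_mul_right lintegral_Phi_Ioc_le _).trans ?_
  rw [← ENNReal.ofReal_mul (by positivity)]
  refine ENNReal.ofReal_le_ofReal ?_
  -- From 1/s < N + 1 ≤ 2N. Hence (4/3)·6/N² = 8/N² is at most 32 s².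
  have h3 : 1 ≤ 2 * N * s := by
    rw [div_lt_iff₀ h0] at hlt
    nlinarith
  rw [div_mul_eq_mul_div, div_le_iff₀ (by positivity)]
  nlinarith [mul_self_nonneg (2 * N * s - 1)]

/-! ### Φ on both sides of an integer -/

/-- Reflection `u ↦ 1 - u` near `0`. -/
lemma Phi_one_sub_add {u : ℝ} (h0 : 0 < u) (h1 : u < 1 / 2) :
    Phi (1 - u) + ENNReal.ofReal (u * Real.log ((1 - u) / u)) = Phi u := by
  have hv : 0 < 1 - u := by linarith
  have hq : u / (1 - u) < 1 := by rw [div_lt_one hv]; linarith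
  have g1 : gauss (1 - u) = u / (1 - u) := by
    have : 1 / (1 - u) = 1 + u / (1 - u) := by field_simp; ring
    rw [gauss_of_ne_zero hv.ne', this, Int.fract_one_add, Int.fract_eq_self]
    exact ⟨by positivity, hq⟩
  have g2 : gauss (u / (1 - u)) = gauss u := by
    have : 1 / (u / (1 - u)) = 1 / u - 1 := by field_simp
    rw [gauss_of_ne_zero (by positivity), gauss_of_ne_zero h0.ne', this, Int.fract_sub_one]
  -- Two Gauss steps from 1 - u reach the same point as one step from u, and the coefficients agree:
  -- (1 - u) · u/(1 - u) = u. Only logarithms remain to be compared.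
  rw [Phi_eq hv.le, transfer, g1, Phi_eq (x := u / (1 - u)) (by positivity), transfer, g2,
    Phi_eq h0.le, transfer, mul_add, ← mul_assoc, ← ENNReal.ofReal_mul hv.le,
    ← ENNReal.ofReal_mul hv.le, mul_div_cancel₀ _ hv.ne', ← add_assoc, add_right_comm]
  congr 1
  have l1 : 0 ≤ Real.log (1 / (1 - u)) := by
    refine Real.log_nonneg ?_; rw [le_div_iff₀ hv]; linarith
  have l2 : 0 ≤ Real.log (1 / (u / (1 - u))) := by
    refine Real.log_nonneg ?_; rw [one_div_div, le_div_iff₀ h0]; linarith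
  have l3 : 0 ≤ Real.log ((1 - u) / u) := by rwa [one_div_div] at l2
  rw [← ENNReal.ofReal_add l1 (by positivity), ← ENNReal.ofReal_add (by positivity) (by positivity)]
  congr 1
  rw [one_div_div, one_div, one_div, Real.log_inv, Real.log_inv, Real.log_div hv.ne' h0.ne']
  ring

lemma Phi_one_sub_le {u : ℝ} (h0 : 0 < u) (h1 : u < 1 / 2) : Phi (1 - u) ≤ Phi u :=
  le_self_add.trans_eq (Phi_one_sub_add h0 h1)

lemma Per_neg {u : ℝ} (h0 : 0 < u) (h1 : u < 1) : Per (-u) = Phi (1 - u) := by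
  rw [Per]
  congr 1
  rw [Int.fract_eq_iff]
  exact ⟨by linarith, by linarith, -1, by push_cast; ring⟩

lemma measurableSet_uIoo {a b : ℝ} : MeasurableSet (uIoo a b) := measurableSet_Ioo

lemma setLIntegral_neg_Ioo {a b : ℝ} {f : ℝ → ℝ≥0∞} (hf : Measurable f) :
    ∫⁻ x in Ioo (-b) (-a), f x = ∫⁻ x in Ioo a b, f (-x) := by
  rw [← (Measure.measurePreserving_neg (volume : Measure ℝ)).setLIntegral_comp_preimage
    measurableSet_Ioo hf]
  simp

/-- Isolates the logarithm as the main term near 0; the transferred part is of second order. -/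
lemma lintegral_Phi_Ioo {a : ℝ} (h0 : 0 < a) (h1 : a ≤ 1) :
    ∫⁻ t in Ioo 0 a, Phi t
      = ENNReal.ofReal (a * Real.log (1 / a) + a) + ∫⁻ t in Ioc 0 a, transfer Phi t := by
  have : ∫⁻ t in Ioo 0 a, Phi t = ∫⁻ t in Ioo 0 a,
      (ENNReal.ofReal (Real.log (1 / t)) + transfer Phi t) :=
    setLIntegral_congr_fun measurableSet_Ioo fun t ht => Phi_eq ht.1.le
  rw [this, lintegral_add_right _ (measurable_transfer measurable_Phi),
    lintegral_log_inv le_rfl h0.le h1, setLIntegral_congr Ioo_ae_eq_Ioc]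
  congr 2
  rw [one_div, Real.log_inv]; ring

lemma lintegral_Phi_Ioo_le {a : ℝ} (h0 : 0 < a) (h1 : a ≤ 1) :
    ∫⁻ t in Ioo 0 a, Phi t ≤ ENNReal.ofReal (a * Real.log (1 / a) + a + 32 * a ^ 2) := by
  have hl : 0 ≤ Real.log (1 / a) := Real.log_nonneg (by rw [le_div_iff₀ h0]; linarith)
  rw [lintegral_Phi_Ioo h0 h1, ENNReal.ofReal_add (p := _ + _) (by positivity) (by positivity)]
  exact add_le_add le_rfl (lintegral_transfer_Phi_le h0 h1)

lemma lintegral_Per_Ioo_neg_le {M : ℝ} (h0 : 0 < M) (h1 : M < 1 / 2) :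
    ∫⁻ t in Ioo (-M) M, Per t ≤ 2 * ∫⁻ t in Ioo 0 M, Phi t := by
  have hsub : Ioo (-M) M ⊆ Ioo (-M) (-0) ∪ Ico 0 M := by
    intro t ht
    rcases lt_or_ge t 0 with h | h
    · exact Or.inl ⟨ht.1, by simpa using h⟩
    · exact Or.inr ⟨h, ht.2⟩
  refine (lintegral_mono_set hsub).trans ((lintegral_union_le _ _ _).trans ?_)
  rw [setLIntegral_neg_Ioo measurable_Per, two_mul, setLIntegral_congr Ico_ae_eq_Ioc,
    ← setLIntegral_congr Ioo_ae_eq_Ioc]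
  refine add_le_add (setLIntegral_mono' measurableSet_Ioo fun u hu => ?_)
    (setLIntegral_mono' measurableSet_Ioo fun u hu => ?_)
  · rw [Per_neg hu.1 (by linarith [hu.2])]
    exact Phi_one_sub_le hu.1 (hu.2.trans h1)
  · rw [Per_eq_Phi ⟨hu.1.le, by linarith [hu.2]⟩]

/-! ### Weighted means and inverse branches -/

/-- A weighted bound for the mean of `f` between `y₀` and `y`, shaped so that it is
compatible with the inverse branches of the Gauss map. -/
def WBound (f : ℝ → ℝ≥0∞) (A : ℝ≥0∞) (y₀ y r : ℝ) : Prop :=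
  ∫⁻ t in uIoo y₀ y, ENNReal.ofReal (((1 + r * t) ^ 3)⁻¹) * f t ≤
    A * ENNReal.ofReal (|y - y₀| * (((1 + r * y₀) ^ 2)⁻¹ * (1 + r * y)⁻¹))

lemma WBound.mono {f : ℝ → ℝ≥0∞} {A B : ℝ≥0∞} {y₀ y r : ℝ} (h : WBound f A y₀ y r)
    (hAB : A ≤ B) : WBound f B y₀ y r := le_trans h (mul_le_mul_left hAB _)

lemma WBound.add {f g : ℝ → ℝ≥0∞} {A B : ℝ≥0∞} {y₀ y r : ℝ} (h : WBound f A y₀ y r)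
    (h' : WBound g B y₀ y r) (hg : Measurable g) : WBound (fun t => f t + g t) (A + B) y₀ y r := by
  unfold WBound at *
  simp only [mul_add]
  rw [lintegral_add_right, add_mul]
  · exact add_le_add h h'
  · exact (Measurable.ennreal_ofReal (by fun_prop)).mul hg

lemma WBound.congr {f g : ℝ → ℝ≥0∞} {A : ℝ≥0∞} {y₀ y r : ℝ} (h : WBound f A y₀ y r)
    (hfg : ∀ t ∈ uIoo y₀ y, g t = f t) : WBound g A y₀ y r := by
  unfold WBound at *
  rwa [setLIntegral_congr_fun (g := fun t => ENNReal.ofReal (((1 + r * t) ^ 3)⁻¹) * f t)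
    measurableSet_uIoo fun t ht => by simp only [hfg t ht]]

/-- All weights lie between 1/8 and 1. This factor is lost only when a bound enters the recursion,
never when it is transported. -/
lemma WBound.of_unweighted {f : ℝ → ℝ≥0∞} {A : ℝ≥0∞} {y₀ y r : ℝ} (hy₀ : y₀ ∈ Icc (0 : ℝ) 1)
    (hy : y ∈ Icc (0 : ℝ) 1) (hr : r ∈ Icc (0 : ℝ) 1)
    (h : ∫⁻ t in uIoo y₀ y, f t ≤ A * ENNReal.ofReal |y - y₀|) :
    WBound f (ENNReal.ofReal 8 * A) y₀ y r := by
  have h1 : ∫⁻ t in uIoo y₀ y, ENNReal.ofReal (((1 + r * t) ^ 3)⁻¹) * f t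
      ≤ ∫⁻ t in uIoo y₀ y, f t := by
    refine setLIntegral_mono' measurableSet_uIoo fun t ht => ?_
    have ht0 : 0 ≤ t := (le_min hy₀.1 hy.1).trans ht.1.le
    refine mul_le_of_le_one_left zero_le (ENNReal.ofReal_le_one.2 ?_)
    exact inv_le_one_of_one_le₀ (one_le_pow₀ (by nlinarith [hr.1]))
  refine h1.trans (h.trans ?_)
  rw [mul_comm (ENNReal.ofReal 8), mul_assoc, ← ENNReal.ofReal_mul (by norm_num)]
  refine mul_le_mul_right (ENNReal.ofReal_le_ofReal ?_) _
  have e1 : 1 + r * y₀ ≤ 2 := by nlinarith [hr.1, hr.2, hy₀.1, hy₀.2]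
  have e2 : 1 + r * y ≤ 2 := by nlinarith [hr.1, hr.2, hy.1, hy.2]
  have p1 : 0 < 1 + r * y₀ := by nlinarith [hr.1, hr.2, hy₀.1, hy₀.2]
  have p2 : 0 < 1 + r * y := by nlinarith [hr.1, hr.2, hy.1, hy.2]
  have q1 : (2⁻¹ : ℝ) ≤ (1 + r * y₀)⁻¹ := inv_anti₀ p1 e1
  have q2 : (2⁻¹ : ℝ) ≤ (1 + r * y)⁻¹ := inv_anti₀ p2 e2
  have q3 : (2⁻¹ : ℝ) ^ 2 * 2⁻¹ ≤ ((1 + r * y₀) ^ 2)⁻¹ * (1 + r * y)⁻¹ := by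
    rw [← inv_pow]; gcongr
  nlinarith [abs_nonneg (y - y₀)]

lemma setLIntegral_uIoo_inv_add_le {m w₀ w : ℝ} (h₀ : 0 < m + w₀) (h : 0 < m + w)
    (G : ℝ → ℝ≥0∞) : ∫⁻ t in uIoo (1 / (m + w₀)) (1 / (m + w)), G t ≤
      ∫⁻ x in uIoo w₀ w, ENNReal.ofReal (((m + x) ^ 2)⁻¹) * G (1 / (m + x)) := by
  have hpos : ∀ x ∈ uIoo w₀ w, 0 < m + x := by
    intro x hx
    rcases min_choice w₀ w with h' | h' <;> have := hx.1 <;> rw [h'] at this <;> linarith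
  rw [← lintegral_image_inv_add m measurableSet_uIoo hpos]
  refine lintegral_mono_set ?_
  have key : ∀ a b t : ℝ, 0 < m + a → 0 < m + b → 1 / (m + a) < t → t < 1 / (m + b) →
      ∃ x, (b < x ∧ x < a) ∧ 1 / (m + x) = t := by
    intro a b t ha hb h1 h2
    have ht : 0 < t := lt_trans (by positivity) h1
    refine ⟨1 / t - m, ⟨?_, ?_⟩, by simp⟩
    · rw [lt_div_iff₀ hb] at h2
      have : m + b < 1 / t := by rw [lt_div_iff₀ ht]; linarith
      linarith
    · rw [div_lt_iff₀ ha] at h1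
      have : 1 / t < m + a := by rw [div_lt_iff₀ ht]; linarith
      linarith
  intro t ht
  rcases le_total w₀ w with hw | hw
  · rw [uIoo_of_ge (one_div_le_one_div_of_le h₀ (by linarith))] at ht
    rw [uIoo_of_le hw]
    exact key _ _ t h h₀ ht.1 ht.2
  · rw [uIoo_of_le (one_div_le_one_div_of_le h (by linarith))] at ht
    rw [uIoo_of_ge hw]
    exact key _ _ t h₀ h ht.1 ht.2

/-- Under t = 1/(n + x) the weight with parameter r becomes, up to a constant factor, the weight
with parameter 1/(n + r), and the right side changes in the same way. The constant acquires exactly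
the factor y₀ = 1/(n + w₀), so no distortion accumulates under iteration. The asymmetric exponents 2
and 1 on the right are chosen for this. -/
lemma WBound.transfer {f : ℝ → ℝ≥0∞} {A : ℝ≥0∞} {n : ℕ} (hn : 1 ≤ n) {w₀ w r : ℝ}
    (hw₀ : w₀ ∈ Ico (0 : ℝ) 1) (hw : w ∈ Ico (0 : ℝ) 1) (hr : 0 ≤ r)
    (h : WBound f A w₀ w (1 / (n + r))) :
    WBound (transfer f) (ENNReal.ofReal (1 / (n + w₀)) * A) (1 / (n + w₀)) (1 / (n + w)) r := by
  have hn' : (1 : ℝ) ≤ n := by exact_mod_cast hn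
  have p0 : 0 < n + w₀ := by linarith [hw₀.1]
  have p : 0 < n + w := by linarith [hw.1]
  have pr : 0 < n + r := by linarith
  unfold WBound at *
  refine (setLIntegral_uIoo_inv_add_le p0 p _).trans ?_
  have e : ∀ x ∈ uIoo w₀ w, ENNReal.ofReal (((n + x) ^ 2)⁻¹) *
      (ENNReal.ofReal (((1 + r * (1 / (n + x))) ^ 3)⁻¹) * Brjuno.transfer f (1 / (n + x)))
      = ENNReal.ofReal (((n + r) ^ 3)⁻¹) *
        (ENNReal.ofReal (((1 + 1 / (n + r) * x) ^ 3)⁻¹) * f x) := by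
    intro x hx
    have hx' : x ∈ Ico (0 : ℝ) 1 :=
      ⟨(le_min hw₀.1 hw.1).trans hx.1.le, hx.2.trans (max_lt hw₀.2 hw.2)⟩
    have px : 0 < n + x := by linarith [hx'.1]
    have hx0 := hx'.1
    rw [Brjuno.transfer, gauss_inv_natCast_add hn hx', ← mul_assoc, ← mul_assoc, ← mul_assoc,
      ← ENNReal.ofReal_mul (by positivity), ← ENNReal.ofReal_mul (by positivity),
      ← ENNReal.ofReal_mul (by positivity)]
    congr 2
    have a1 : 1 + r * (1 / (n + x)) = (n + x + r) / (n + x) := by field_simp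
    have a2 : 1 + 1 / (n + r) * x = (n + x + r) / (n + r) := by field_simp; ring
    rw [a1, a2]
    have : 0 < n + x + r := by positivity
    field_simp
  rw [setLIntegral_congr_fun measurableSet_uIoo e, lintegral_const_mul' _ _ ENNReal.ofReal_ne_top]
  refine (mul_le_mul_right h _).trans_eq ?_
  rw [mul_left_comm, mul_comm (ENNReal.ofReal (1 / (n + w₀))), mul_assoc A]
  have hw₀' := hw₀.1
  have hw' := hw.1
  rw [← ENNReal.ofReal_mul (by positivity), ← ENNReal.ofReal_mul (by positivity)]
  congr 2
  have b1 : 1 / (n + w) - 1 / (n + w₀) = -(w - w₀) * ((n + w) * (n + w₀))⁻¹ := by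
    field_simp; ring
  have a1 : 1 + r * (1 / (n + w)) = (n + w + r) / (n + w) := by field_simp
  have a2 : 1 + 1 / (n + r) * w = (n + w + r) / (n + r) := by field_simp; ring
  have a3 : 1 + r * (1 / (n + w₀)) = (n + w₀ + r) / (n + w₀) := by field_simp
  have a4 : 1 + 1 / (n + r) * w₀ = (n + w₀ + r) / (n + r) := by field_simp; ring
  rw [b1, abs_mul, abs_neg, abs_of_pos (by positivity : 0 < ((n + w) * (n + w₀))⁻¹), a1, a2, a3, a4]
  have : 0 < n + w + r := by positivity
  have : 0 < n + w₀ + r := by positivity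
  field_simp

/-! ### Means of the logarithm and truncated Brjuno sums -/

lemma lintegral_log_inv_uIoo_le {y₀ y : ℝ} (hy₀ : y₀ ∈ Ioo (0 : ℝ) 1) (hy : y ∈ Icc (0 : ℝ) 1) :
    ∫⁻ t in uIoo y₀ y, ENNReal.ofReal (Real.log (1 / t)) ≤
      ENNReal.ofReal (min (Real.log (1 / y₀)) (Real.log (1 / |y - y₀|)) + 1) *
        ENNReal.ofReal |y - y₀| := by
  have key : ∀ a b : ℝ, 0 ≤ a → a < b → b ≤ 1 →
      (b - a - b * Real.log b + a * Real.log a ≤ (-Real.log (b - a) + 1) * (b - a)) ∧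
      (b - a - b * Real.log b + a * Real.log a ≤ (-Real.log b + 1) * (b - a)) ∧
      (b - a - b * Real.log b + a * Real.log a ≤ (-Real.log a + 1) * (b - a) ∨ a = 0) := by
    intro a b ha hab hb
    have hb0 : 0 < b := by linarith
    have l1 : Real.log (b - a) ≤ Real.log b := Real.log_le_log (by linarith) (by linarith)
    have l2 : a * Real.log a ≤ a * Real.log b := by
      rcases ha.eq_or_lt with rfl | ha
      · simp
      · exact mul_le_mul_of_nonneg_left (Real.log_le_log ha hab.le) ha.le
    refine ⟨?_, ?_, ?_⟩
    · nlinarith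
    · nlinarith
    · rcases ha.eq_or_lt with rfl | ha
      · right; rfl
      · left
        have l3 : Real.log a ≤ Real.log b := Real.log_le_log ha hab.le
        nlinarith
  rcases eq_or_ne y y₀ with rfl | hne
  · simp
  have hpos : 0 < |y - y₀| := abs_pos.2 (sub_ne_zero.2 hne)
  have hle1 : |y - y₀| ≤ 1 := by
    rw [abs_le]; constructor <;> linarith [hy.1, hy.2, hy₀.1, hy₀.2]
  rw [← ENNReal.ofReal_mul (add_nonneg (le_min (Real.log_nonneg (by
    rw [le_div_iff₀ hy₀.1]; linarith [hy₀.2])) (Real.log_nonneg (by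
    rw [le_div_iff₀ hpos]; linarith))) zero_le_one), min_def]
  rcases hne.lt_or_gt with h | h
  · rw [uIoo_of_ge h.le, lintegral_log_inv hy.1 h.le hy₀.2.le, abs_sub_comm,
      abs_of_pos (sub_pos.2 h)]
    refine ENNReal.ofReal_le_ofReal ?_
    obtain ⟨k1, k2, -⟩ := key y y₀ hy.1 h hy₀.2.le
    rw [one_div, one_div, Real.log_inv, Real.log_inv]
    split_ifs
    exacts [k2, k1]
  · rw [uIoo_of_le h.le, lintegral_log_inv hy₀.1.le h.le hy.2, abs_of_pos (sub_pos.2 h)]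
    refine ENNReal.ofReal_le_ofReal ?_
    obtain ⟨k1, -, k2⟩ := key y₀ y hy₀.1.le h hy.2
    have k3 := k2.resolve_right hy₀.1.ne'
    rw [one_div, one_div, Real.log_inv, Real.log_inv]
    split_ifs
    exacts [k3, k1]

/-- The truncated Brjuno sum `∑ β_{k-1} min(log(1/α_k), L)`. -/
def truncPhi (L x : ℝ) : ℝ≥0∞ :=
  ∑' k : ℕ, ENNReal.ofReal (beta k x * min (Real.log (1 / alpha k x)) L)

lemma truncPhi_mono {L L' x : ℝ} (hx : 0 ≤ x) (h : L ≤ L') : truncPhi L x ≤ truncPhi L' x :=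
  ENNReal.tsum_le_tsum fun k => ENNReal.ofReal_le_ofReal
    (mul_le_mul_of_nonneg_left (min_le_min le_rfl h) (beta_nonneg hx k))

lemma truncPhi_le_Phi {L x : ℝ} (hx : 0 ≤ x) : truncPhi L x ≤ Phi x :=
  ENNReal.tsum_le_tsum fun k => ENNReal.ofReal_le_ofReal <| by
    rw [gammaTerm_eq]; exact mul_le_mul_of_nonneg_left (min_le_left _ _) (beta_nonneg hx k)

lemma truncPhi_eq {L x : ℝ} (hx : 0 ≤ x) : truncPhi L x =
    ENNReal.ofReal (min (Real.log (1 / x)) L) + ENNReal.ofReal x * truncPhi L (gauss x) := by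
  unfold truncPhi
  rw [tsum_eq_zero_add' ENNReal.summable, ← ENNReal.tsum_mul_left]
  simp only [beta_zero, one_mul, alpha_zero, beta_succ, alpha_succ', mul_assoc,
    ENNReal.ofReal_mul hx]

lemma le_truncPhi {L x : ℝ} (hx : 0 ≤ x) :
    ENNReal.ofReal (min (Real.log (1 / x)) L) ≤ truncPhi L x := by
  rw [truncPhi_eq hx]; exact le_self_add

lemma exists_nat_between_of_floor_ne {v₀ v : ℝ} (h₀ : 1 ≤ v₀) (h : 1 ≤ v)
    (hfl : ⌊v₀⌋₊ ≠ ⌊v⌋₊) : ∃ m : ℕ, 2 ≤ m ∧ ((v₀ < m ∧ m ≤ v) ∨ (v < m ∧ m ≤ v₀)) := by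
  rcases hfl.lt_or_gt with hl | hl
  · refine ⟨⌊v⌋₊, ?_, Or.inl ⟨(Nat.floor_lt' (by omega)).1 hl, Nat.floor_le (by linarith)⟩⟩
    have : 1 ≤ ⌊v₀⌋₊ := Nat.le_floor (by exact_mod_cast h₀)
    omega
  · refine ⟨⌊v₀⌋₊, ?_, Or.inr ⟨(Nat.floor_lt' (by omega)).1 hl, Nat.floor_le (by linarith)⟩⟩
    have : 1 ≤ ⌊v⌋₊ := Nat.le_floor (by exact_mod_cast h)
    omega

/-- If `1/x` is close to an integer, then `Φ(x)` has a large term, and so has its truncation. -/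
lemma mul_min_le_truncPhi {x : ℝ} (h0 : 0 < x) (h1 : x ≤ 1) {m : ℕ} {w L : ℝ}
    (hm : 1 / x = m + w) (hw : |w| < 1 / 3) (hw0 : w ≠ 0) (hL : 0 ≤ L) :
    ENNReal.ofReal (x * min (Real.log (1 / |w|)) L) ≤
      ENNReal.ofReal (3 / 2) * truncPhi L x + ENNReal.ofReal 1 := by
  rw [abs_lt] at hw
  have hbase : ENNReal.ofReal x * truncPhi L (gauss x) ≤ truncPhi L x := by
    rw [truncPhi_eq h0.le]; exact le_add_self
  have hg : gauss x = Int.fract w := by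
    rw [gauss_of_ne_zero h0.ne', hm, Int.fract_natCast_add]
  -- For w > 0 the next iterate is w. For w = -u < 0 it is 1 - u, and the large logarithm appears
  -- one step later, at u/(1 - u), with coefficient x(1 - u) ≥ 2x/3: hence the factor 3/2. The loss
  -- log(1 - u) ≥ -1/2 goes into the additive constant.
  rcases hw0.lt_or_gt with hneg | hpos
  · set u := -w with hu
    have hu0 : 0 < u := by linarith
    have hu1 : u < 1 / 3 := by linarith
    have hv : 0 < 1 - u := by linarith
    have hg1 : gauss x = 1 - u := by
      rw [hg, Int.fract_eq_iff]
      exact ⟨by linarith, by linarith, -1, by push_cast; ring⟩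
    have hg2 : gauss (1 - u) = u / (1 - u) := by
      have : 1 / (1 - u) = 1 + u / (1 - u) := by field_simp; ring
      rw [gauss_of_ne_zero hv.ne', this, Int.fract_one_add, Int.fract_eq_self]
      exact ⟨by positivity, by rw [div_lt_one hv]; linarith⟩
    have e1 : ENNReal.ofReal (1 - u) * ENNReal.ofReal (min (Real.log (1 / (u / (1 - u)))) L)
        ≤ truncPhi L (gauss x) := by
      rw [hg1, truncPhi_eq hv.le, hg2]
      exact le_add_of_nonneg_of_le zero_le (mul_le_mul_right (le_truncPhi (by positivity)) _)
    have e2 : ENNReal.ofReal x * (ENNReal.ofReal (1 - u) *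
        ENNReal.ofReal (min (Real.log (1 / (u / (1 - u)))) L)) ≤ truncPhi L x :=
      (mul_le_mul_right e1 _).trans hbase
    refine le_trans ?_ (add_le_add (mul_le_mul_right e2 _) le_rfl)
    have l2 : 0 ≤ Real.log (1 / (u / (1 - u))) := by
      refine Real.log_nonneg ?_; rw [one_div_div, le_div_iff₀ hu0]; linarith
    rw [← ENNReal.ofReal_mul hv.le, ← ENNReal.ofReal_mul h0.le, ← ENNReal.ofReal_mul (by norm_num),
      ← ENNReal.ofReal_add (mul_nonneg (by norm_num) (mul_nonneg h0.le
        (mul_nonneg hv.le (le_min l2 hL)))) zero_le_one]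
    refine ENNReal.ofReal_le_ofReal ?_
    have habs : |w| = u := by rw [abs_of_neg hneg]
    rw [habs]
    have e3 : Real.log (1 / (u / (1 - u))) = Real.log (1 / u) + Real.log (1 - u) := by
      rw [one_div_div, Real.log_div hv.ne' hu0.ne', one_div, Real.log_inv]; ring
    have e4 : -(1 / 2 : ℝ) ≤ Real.log (1 - u) := by
      have := Real.one_sub_inv_le_log_of_pos hv
      have h6 : (1 - u)⁻¹ ≤ 3 / 2 := by
        rw [inv_le_comm₀ hv (by norm_num)]; linarith
      linarith
    have e5 : min (Real.log (1 / u)) L ≤ min (Real.log (1 / (u / (1 - u)))) L + 1 / 2 := by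
      rw [e3, ← min_add_add_right]
      exact min_le_min (by linarith) (by linarith)
    set M := min (Real.log (1 / (u / (1 - u)))) L
    have hM : 0 ≤ M := le_min l2 hL
    have : 1 ≤ 3 / 2 * (1 - u) := by linarith
    have h7 : x * min (Real.log (1 / u)) L ≤ x * (M + 1 / 2) := mul_le_mul_of_nonneg_left e5 h0.le
    have h8 : x * M ≤ 3 / 2 * (1 - u) * (x * M) :=
      le_mul_of_one_le_left (mul_nonneg h0.le hM) this
    nlinarith
  · have hg1 : gauss x = w := by rw [hg, Int.fract_eq_self]; exact ⟨hpos.le, by linarith⟩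
    have e1 : ENNReal.ofReal x * ENNReal.ofReal (min (Real.log (1 / w)) L) ≤ truncPhi L x := by
      refine le_trans (mul_le_mul_right ?_ _) hbase
      rw [hg1]; exact le_truncPhi hpos.le
    rw [abs_of_pos hpos, ENNReal.ofReal_mul h0.le]
    refine e1.trans (le_add_right (le_mul_of_one_le_left zero_le (ENNReal.one_le_ofReal.2 ?_)))
    norm_num

/-! ### Intervals that leave a branch of the Gauss map -/

/-- The interval is long compared with the square of its distance from 0, so the bound 32 s² on all
of (0, s] is enough; 256 = 32 · 8. -/
lemma lintegral_transfer_Phi_far {y₀ y : ℝ} (hy₀ : y₀ ∈ Ioo (0 : ℝ) 1) (hy : y ∈ Icc (0 : ℝ) 1)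
    (h : max y₀ y ^ 2 ≤ 8 * |y - y₀|) :
    ∫⁻ t in uIoo y₀ y, transfer Phi t ≤ ENNReal.ofReal 256 * ENNReal.ofReal |y - y₀| := by
  have h1 : uIoo y₀ y ⊆ Ioc 0 (max y₀ y) := fun t ht =>
    ⟨lt_of_le_of_lt (le_min hy₀.1.le hy.1) ht.1, ht.2.le⟩
  refine (lintegral_mono_set h1).trans ((lintegral_transfer_Phi_le (lt_max_of_lt_left hy₀.1)
    (max_le hy₀.2.le hy.2)).trans ?_)
  rw [← ENNReal.ofReal_mul (by norm_num)]
  exact ENNReal.ofReal_le_ofReal (by linarith)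

set_option maxHeartbeats 1000000 in
/-- Mean of `t Φ({1/t})` over an interval whose image under `1/t` crosses an integer. -/
lemma lintegral_transfer_Phi_near {y₀ y : ℝ} (hy₀ : y₀ ∈ Ioo (0 : ℝ) 1) (hy : y ∈ Ioc (0 : ℝ) 1)
    (hirr : Irrational y₀) (hfl : ⌊1 / y₀⌋₊ ≠ ⌊1 / y⌋₊)
    (h : 8 * |y - y₀| < max y₀ y ^ 2) :
    ∫⁻ t in uIoo y₀ y, transfer Phi t ≤
      (ENNReal.ofReal 128 * (truncPhi (Real.log (1 / |y - y₀|)) y₀ + 1))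
        * ENNReal.ofReal |y - y₀| := by
  obtain ⟨m, hm, hcross⟩ := exists_nat_between_of_floor_ne (v₀ := 1 / y₀) (v := 1 / y)
    (by rw [le_div_iff₀ hy₀.1]; linarith [hy₀.2]) (by rw [le_div_iff₀ hy.1]; linarith [hy.2]) hfl
  obtain ⟨w₀, hw₀⟩ : ∃ w₀, 1 / y₀ = m + w₀ := ⟨1 / y₀ - m, by ring⟩
  obtain ⟨w, hw⟩ : ∃ w, 1 / y = m + w := ⟨1 / y - m, by ring⟩
  have hy₀0 := hy₀.1
  have hy0 := hy.1
  set M₀ := max y₀ y with hM₀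
  have hM₀1 : M₀ ≤ 1 := max_le hy₀.2.le hy.2
  have hM₀0 : 0 < M₀ := lt_max_of_lt_left hy₀0
  have hd : |y - y₀| < M₀ / 4 := by
    have : M₀ ^ 2 ≤ M₀ := by rw [sq]; exact mul_le_of_le_one_left hM₀0.le hM₀1
    linarith
  have hlow₀ : 3 / 4 * M₀ ≤ y₀ := by
    rw [abs_lt] at hd
    rcases max_choice y₀ y with h' | h' <;> rw [← hM₀] at h' <;> linarith
  have hlow : 3 / 4 * M₀ ≤ y := by
    rw [abs_lt] at hd
    rcases max_choice y₀ y with h' | h' <;> rw [← hM₀] at h' <;> linarith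
  have hyM : y ≤ M₀ := le_max_right _ _
  have hyM₀ : y₀ ≤ M₀ := le_max_left _ _
  have hw₀0 : w₀ ≠ 0 := by
    rintro rfl
    refine hirr.ne_rat (1 / m) ?_
    have : y₀ = 1 / (1 / y₀) := by simp
    rw [this, hw₀]; simp
  have hne : y ≠ y₀ := by rintro rfl; exact hfl rfl
  have hδ : 0 < |y - y₀| := abs_pos.2 (sub_ne_zero.2 hne)
  have hδ1 : |y - y₀| ≤ 1 := by linarith
  -- the two displacements
  have hdiff : |w - w₀| * (y * y₀) = |y - y₀| := by
    have : w - w₀ = (y₀ - y) / (y * y₀) := by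
      have : w - w₀ = 1 / y - 1 / y₀ := by rw [hw, hw₀]; ring
      rw [this]; field_simp
    rw [this, abs_div, abs_of_pos (mul_pos hy0 hy₀0), abs_sub_comm,
      div_mul_cancel₀ _ (mul_pos hy0 hy₀0).ne']
  have h3 : M₀ ^ 2 * (9 / 16) ≤ y * y₀ := by
    have := mul_le_mul hlow hlow₀ (by positivity) hy0.le
    linarith
  have hD3 : |w - w₀| < 1 / 3 := by
    by_contra! hc
    have : 1 / 3 * (y * y₀) ≤ |w - w₀| * (y * y₀) :=
      mul_le_mul_of_nonneg_right hc (mul_pos hy0 hy₀0).le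
    have : 0 < M₀ ^ 2 := by positivity
    linarith
  -- The integer m separates 1/y₀ from 1/y, so w₀ and w lie on opposite sides of 0.
  have hsum : |w| + |w₀| ≤ |w - w₀| := by
    rcases hcross with ⟨a, b⟩ | ⟨a, b⟩ <;> rw [hw₀] at * <;> rw [hw] at *
    · rw [abs_of_nonneg (a := w) (by linarith), abs_of_neg (a := w₀) (by linarith),
        abs_of_pos (by linarith)]; linarith
    · rw [abs_of_neg (a := w) (by linarith), abs_of_nonneg (a := w₀) (by linarith),
        abs_of_neg (by linarith)]; linarith
  have hDle : |w - w₀| ≤ |w| + |w₀| := abs_sub _ _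
  set M := max |w₀| |w| with hM
  have hMw₀ : |w₀| ≤ M := le_max_left _ _
  have hMw : |w| ≤ M := le_max_right _ _
  have hw₀pos : 0 < |w₀| := abs_pos.2 hw₀0
  have hM0 : 0 < M := hw₀pos.trans_le hMw₀
  have hMD : M ≤ |w - w₀| := max_le (by linarith [abs_nonneg w]) (by linarith)
  have hm' : (2 : ℝ) ≤ m := by exact_mod_cast hm
  -- change of variable
  have hy₀' : y₀ = 1 / (m + w₀) := by rw [← hw₀]; simp
  have hy' : y = 1 / (m + w) := by rw [← hw]; simp
  have step1 : ∫⁻ t in uIoo y₀ y, transfer Phi t ≤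
      ENNReal.ofReal (M₀ ^ 3) * ∫⁻ x in uIoo w₀ w, Per x := by
    rw [hy₀', hy', ← lintegral_const_mul' _ _ ENNReal.ofReal_ne_top]
    refine (setLIntegral_uIoo_inv_add_le (by rw [← hw₀]; positivity) (by rw [← hw]; positivity)
      _).trans (setLIntegral_mono' measurableSet_uIoo fun x hx => ?_)
    have hmx : 1 / M₀ ≤ m + x := by
      have a1 : 1 / M₀ ≤ m + w₀ := by rw [← hw₀]; exact one_div_le_one_div_of_le hy₀0 hyM₀
      have a2 : 1 / M₀ ≤ m + w := by rw [← hw]; exact one_div_le_one_div_of_le hy0 hyM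
      have := hx.1
      rcases min_choice w₀ w with h' | h' <;> rw [h'] at this <;> linarith
    have hmx0 : 0 < m + x := lt_of_lt_of_le (by positivity) hmx
    rw [transfer, gauss_of_ne_zero (by positivity), one_div_one_div, ← mul_assoc,
      ← ENNReal.ofReal_mul (by positivity), Int.fract_natCast_add]
    refine mul_le_mul_left (ENNReal.ofReal_le_ofReal ?_) _
    have : 1 / (m + x) ≤ M₀ := by
      rw [one_div_le hmx0 hM₀0]; exact hmx
    calc ((m + x) ^ 2)⁻¹ * (1 / (m + x)) = (1 / (m + x)) ^ 3 := by field_simp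
      _ ≤ M₀ ^ 3 := by gcongr
  -- Enlarging to (-M, M) costs only a factor 2, by reflection. Since M < 1/3, the terms M + 32 M²
  -- are at most 12 M.
  have step2 : ∫⁻ x in uIoo w₀ w, Per x ≤
      ENNReal.ofReal (2 * (M * (Real.log (1 / M) + 12))) := by
    have hs : uIoo w₀ w ⊆ Ioo (-M) M := by
      intro x hx
      have := neg_abs_le w₀
      have := neg_abs_le w
      have := le_abs_self w₀
      have := le_abs_self w
      refine ⟨lt_of_le_of_lt (le_min ?_ ?_) hx.1, lt_of_lt_of_le hx.2 (max_le ?_ ?_)⟩ <;> linarith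
    refine (lintegral_mono_set hs).trans ((lintegral_Per_Ioo_neg_le hM0 (by linarith)).trans ?_)
    refine (mul_le_mul_right (lintegral_Phi_Ioo_le hM0 (by linarith)) _).trans ?_
    rw [ENNReal.ofReal_mul (by norm_num), ENNReal.ofReal_ofNat]
    refine mul_le_mul_right (ENNReal.ofReal_le_ofReal ?_) _
    nlinarith
  refine (step1.trans (mul_le_mul_right step2 _)).trans ?_
  rw [← ENNReal.ofReal_mul (by positivity)]
  set L := Real.log (1 / |y - y₀|) with hL
  have hL0 : 0 ≤ L := Real.log_nonneg (by rw [le_div_iff₀ hδ]; linarith)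
  -- M dominates both |w₀| and half of |w - w₀| ≥ |y - y₀|, so its logarithm is controlled by the
  -- capped one at w₀; log 2 < 1 absorbs the half.
  have hlogM : Real.log (1 / M) ≤ min (Real.log (1 / |w₀|)) L + 1 := by
    rw [← min_add_add_right]
    refine le_min ?_ ?_
    · have : Real.log (1 / M) ≤ Real.log (1 / |w₀|) :=
        Real.log_le_log (by positivity) (one_div_le_one_div_of_le hw₀pos hMw₀)
      linarith
    · have h1 : |y - y₀| ≤ 2 * M := by
        have : y * y₀ ≤ 1 := mul_le_one₀ hy.2 hy₀0.le hy₀.2.le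
        have := mul_le_of_le_one_right (abs_nonneg (w - w₀)) this
        have := le_max_left |w₀| |w|
        have := le_max_right |w₀| |w|
        linarith
      have h2 : Real.log (1 / M) ≤ Real.log (2 * (1 / |y - y₀|)) := by
        refine Real.log_le_log (by positivity) ?_
        rw [mul_one_div, div_le_div_iff₀ hM0 hδ]; linarith
      rw [Real.log_mul (by norm_num) (by positivity)] at h2
      have := Real.log_two_lt_d9
      linarith
  have hmin0 : 0 ≤ min (Real.log (1 / |w₀|)) L := le_min (Real.log_nonneg (by
    rw [le_div_iff₀ hw₀pos]; linarith)) hL0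
  have key := mul_min_le_truncPhi hy₀0 hy₀.2.le hw₀ (by linarith [abs_nonneg w] : |w₀| < 1 / 3)
    hw₀0 hL0
  set mn := min (Real.log (1 / |w₀|)) L
  have hreal : M₀ ^ 3 * (2 * (M * (Real.log (1 / M) + 12))) ≤ (7 * (y₀ * mn + 13)) * |y - y₀| := by
    have h1 : M₀ ^ 3 * M ≤ (7 / 2) * y₀ * |y - y₀| := by
      have h4 : M₀ ^ 2 * M * (9 / 16) ≤ |y - y₀| := by
        calc M₀ ^ 2 * M * (9 / 16) = (M₀ ^ 2 * (9 / 16)) * M := by ring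
          _ ≤ (y * y₀) * |w - w₀| := by gcongr
          _ = |y - y₀| := by rw [← hdiff]; ring
      have h5 : M₀ ≤ 4 / 3 * y₀ := by linarith
      calc M₀ ^ 3 * M = M₀ * (M₀ ^ 2 * M) := by ring
        _ ≤ (4 / 3 * y₀) * (16 / 9 * |y - y₀|) :=
          mul_le_mul h5 (by linarith) (by positivity) (by positivity)
        _ = (64 / 27) * (y₀ * |y - y₀|) := by ring
        _ ≤ (7 / 2) * (y₀ * |y - y₀|) :=
          mul_le_mul_of_nonneg_right (by norm_num) (by positivity)
        _ = (7 / 2) * y₀ * |y - y₀| := by ring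
    have h6 : 0 ≤ M₀ ^ 3 * M := by positivity
    calc M₀ ^ 3 * (2 * (M * (Real.log (1 / M) + 12)))
        = 2 * (M₀ ^ 3 * M) * (Real.log (1 / M) + 12) := by ring
      _ ≤ 2 * (M₀ ^ 3 * M) * (mn + 13) :=
        mul_le_mul_of_nonneg_left (by linarith) (by positivity)
      _ ≤ 2 * ((7 / 2) * y₀ * |y - y₀|) * (mn + 13) := by gcongr
      _ = 7 * (y₀ * mn + 13 * y₀) * |y - y₀| := by ring
      _ ≤ _ := by
        have := hy₀.2
        gcongr; linarith
  refine (ENNReal.ofReal_le_ofReal hreal).trans ?_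
  rw [ENNReal.ofReal_mul (by positivity)]
  refine mul_le_mul_left ?_ _
  rw [ENNReal.ofReal_mul (by norm_num), ENNReal.ofReal_add (by positivity) (by norm_num)]
  refine (mul_le_mul_right (add_le_add key le_rfl) _).trans ?_
  rw [mul_add, mul_add, mul_add, ← mul_assoc, add_assoc, ← mul_add]
  refine add_le_add (mul_le_mul_left ?_ _) ?_
  · rw [← ENNReal.ofReal_mul (by norm_num)]
    exact ENNReal.ofReal_le_ofReal (by norm_num)
  · rw [← ENNReal.ofReal_add (by norm_num) (by norm_num), ← ENNReal.ofReal_mul (by norm_num),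
      mul_one]
    exact ENNReal.ofReal_le_ofReal (by norm_num)

lemma lintegral_transfer_Phi_of_floor_ne {y₀ y : ℝ} (hy₀ : y₀ ∈ Ioo (0 : ℝ) 1)
    (hy : y ∈ Icc (0 : ℝ) 1) (hirr : Irrational y₀)
    (hfl : y = 0 ∨ ⌊1 / y₀⌋₊ ≠ ⌊1 / y⌋₊) :
    ∫⁻ t in uIoo y₀ y, transfer Phi t ≤
      (ENNReal.ofReal 256 * (truncPhi (Real.log (1 / |y - y₀|)) y₀ + 1))
        * ENNReal.ofReal |y - y₀| := by
  by_cases h : max y₀ y ^ 2 ≤ 8 * |y - y₀|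
  · refine (lintegral_transfer_Phi_far hy₀ hy h).trans (mul_le_mul_left ?_ _)
    exact le_mul_of_one_le_right zero_le le_add_self
  · push Not at h
    have hy0 : y ≠ 0 := by
      rintro rfl
      rw [max_eq_left hy₀.1.le, zero_sub, abs_neg, abs_of_pos hy₀.1] at h
      nlinarith [hy₀.1, hy₀.2]
    refine (lintegral_transfer_Phi_near hy₀ ⟨hy.1.lt_of_ne' hy0, hy.2⟩ hirr
      (hfl.resolve_left hy0) h).trans ?_
    refine mul_le_mul_left (mul_le_mul_left (ENNReal.ofReal_le_ofReal (by norm_num)) _) _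

lemma eq_inv_floor_add_gauss {y : ℝ} (h0 : 0 < y) : y = 1 / (⌊1 / y⌋₊ + gauss y) := by
  rw [gauss_of_ne_zero h0.ne', Int.fract, natCast_floor_eq_intCast_floor (by positivity)]
  simp

/-! ### The maximal inequality -/

/-- The maximal inequality for the partial sums of `Φ`. -/
lemma wBound_head (K : ℕ) {y₀ y r : ℝ} (hy₀ : y₀ ∈ Ioo (0 : ℝ) 1) (hirr : Irrational y₀)
    (hy : y ∈ Icc (0 : ℝ) 1) (hr : r ∈ Icc (0 : ℝ) 1) :
    WBound (head K) (ENNReal.ofReal 2056 *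
      (truncPhi (Real.log (1 / |y - y₀|)) y₀ + ENNReal.ofReal (2 + y₀))) y₀ y r := by
  induction K generalizing y₀ y r with
  | zero => simp [WBound, head]
  | succ K ih =>
    rcases eq_or_ne y y₀ with rfl | hne
    · simp [WBound]
    have hy₀I : y₀ ∈ Icc (0 : ℝ) 1 := ⟨hy₀.1.le, hy₀.2.le⟩
    have hδ : 0 < |y - y₀| := abs_pos.2 (sub_ne_zero.2 hne)
    have hδ1 : |y - y₀| ≤ 1 := by
      rw [abs_le]; constructor <;> linarith [hy.1, hy.2, hy₀.1, hy₀.2]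
    have hL0 : 0 ≤ Real.log (1 / |y - y₀|) :=
      Real.log_nonneg (by rw [le_div_iff₀ hδ]; linarith)
    have hmin : 0 ≤ min (Real.log (1 / y₀)) (Real.log (1 / |y - y₀|)) :=
      le_min (Real.log_nonneg (by rw [le_div_iff₀ hy₀.1]; linarith [hy₀.2])) hL0
    have hlog := WBound.of_unweighted (r := r) hy₀I hy hr (lintegral_log_inv_uIoo_le hy₀ hy)
    have hcongr : ∀ t ∈ uIoo y₀ y, head (K + 1) t =
        ENNReal.ofReal (Real.log (1 / t)) + transfer (head K) t := fun t ht =>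
      head_succ ((le_min hy₀.1.le hy.1).trans ht.1.le) K
    have hmeas := measurable_transfer (measurable_head K)
    by_cases hfl : y = 0 ∨ ⌊1 / y₀⌋₊ ≠ ⌊1 / y⌋₊
    -- The points separate: the induction hypothesis is not needed, since the bound for all of TΦ
    -- applies. The constant is 2056 = 8 + 8 · 256.
    · have h2 : WBound (transfer (head K)) _ y₀ y r :=
        WBound.of_unweighted hy₀I hy hr ((lintegral_mono fun t =>
          mul_le_mul_right (head_le_Phi K _) _).trans
          (lintegral_transfer_Phi_of_floor_ne hy₀ hy hirr hfl))
      refine ((hlog.add h2 hmeas).congr hcongr).mono ?_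
      have h3 : ENNReal.ofReal (min (Real.log (1 / y₀)) (Real.log (1 / |y - y₀|)) + 1)
          ≤ truncPhi (Real.log (1 / |y - y₀|)) y₀ + 1 := by
        rw [ENNReal.ofReal_add hmin zero_le_one, ENNReal.ofReal_one]
        exact add_le_add (le_truncPhi hy₀.1.le) le_rfl
      refine (add_le_add (mul_le_mul_right h3 _) le_rfl).trans ?_
      rw [← mul_assoc, ← ENNReal.ofReal_mul (by norm_num), ← add_mul,
        ← ENNReal.ofReal_add (by norm_num) (by norm_num)]
      refine mul_le_mul' (ENNReal.ofReal_le_ofReal (by norm_num)) (add_le_add le_rfl ?_)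
      exact ENNReal.one_le_ofReal.2 (by linarith [hy₀.1])
    · push Not at hfl
      obtain ⟨hy0, hfl⟩ := hfl
      have hyp : 0 < y := hy.1.lt_of_ne' hy0
      set n := ⌊1 / y₀⌋₊ with hn
      have hn1 : 1 ≤ n := Nat.le_floor (by
        rw [Nat.cast_one, le_div_iff₀ hy₀.1]; linarith [hy₀.2])
      have e₀ : y₀ = 1 / (n + gauss y₀) := eq_inv_floor_add_gauss hy₀.1
      have e : y = 1 / (n + gauss y) := by rw [hfl]; exact eq_inv_floor_add_gauss hyp
      have hn1' : (1 : ℝ) ≤ n := by exact_mod_cast hn1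
      have hr' : 1 / (n + r) ∈ Icc (0 : ℝ) 1 :=
        ⟨by have := hr.1; positivity, by
          rw [div_le_one (by linarith [hr.1])]; linarith [hr.1]⟩
      have h2 := WBound.transfer hn1 ⟨gauss_nonneg y₀, gauss_lt_one y₀⟩
        ⟨gauss_nonneg y, gauss_lt_one y⟩ hr.1
        (ih (gauss_mem_Ioo hirr) (gauss_irrational hirr)
          ⟨gauss_nonneg y, (gauss_lt_one y).le⟩ hr')
      rw [← e₀, ← e] at h2
      refine ((hlog.add h2 hmeas).congr hcongr).mono ?_
      -- Each branch is expanding, so the cap at the next level is lower and may be raised back to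
      -- log(1/|y - y₀|), as the recursion of `truncPhi` requires.
      have hg : |y - y₀| ≤ |gauss y - gauss y₀| := by
        have : y - y₀ = -(y * y₀) * (gauss y - gauss y₀) := by
          have a1 : gauss y = 1 / y - n := by
            conv_rhs => rw [e]
            simp
          have a2 : gauss y₀ = 1 / y₀ - n := by
            conv_rhs => rw [e₀]
            simp
          rw [a1, a2]
          have := hy₀.1.ne'
          field_simp; ring
        rw [this, abs_mul, abs_neg, abs_of_pos (mul_pos hyp hy₀.1)]
        exact mul_le_of_le_one_left (abs_nonneg _) (mul_le_one₀ hy.2 hy₀.1.le hy₀.2.le)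
      have hL : Real.log (1 / |gauss y - gauss y₀|) ≤ Real.log (1 / |y - y₀|) :=
        Real.log_le_log (by have := hδ.trans_le hg; positivity) (one_div_le_one_div_of_le hδ hg)
      have h3 := truncPhi_mono (x := gauss y₀) (gauss_nonneg _) hL
      have h4 := one_add_mul_gauss_le hy₀.1.le hy₀.2.le
      rw [truncPhi_eq hy₀.1.le]
      set T := truncPhi (Real.log (1 / |y - y₀|)) (gauss y₀)
      set mn := min (Real.log (1 / y₀)) (Real.log (1 / |y - y₀|))
      have hg0 := gauss_nonneg y₀
      have hy00 := hy₀.1.le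
      calc ENNReal.ofReal 8 * ENNReal.ofReal (mn + 1) + ENNReal.ofReal y₀ * (ENNReal.ofReal 2056 *
            (truncPhi (Real.log (1 / |gauss y - gauss y₀|)) (gauss y₀)
              + ENNReal.ofReal (2 + gauss y₀)))
          ≤ ENNReal.ofReal 2056 * (ENNReal.ofReal mn + 1) + ENNReal.ofReal y₀ *
            (ENNReal.ofReal 2056 * (T + ENNReal.ofReal (2 + gauss y₀))) := by
            rw [ENNReal.ofReal_add hmin zero_le_one, ENNReal.ofReal_one]
            gcongr
            norm_num
        _ = ENNReal.ofReal 2056 * (ENNReal.ofReal mn + ENNReal.ofReal y₀ * T +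
            (1 + ENNReal.ofReal y₀ * ENNReal.ofReal (2 + gauss y₀))) := by ring
        _ ≤ _ := by
            refine mul_le_mul_right (add_le_add le_rfl ?_) _
            rw [← ENNReal.ofReal_one, ← ENNReal.ofReal_mul hy00,
              ← ENNReal.ofReal_add zero_le_one (by positivity)]
            exact ENNReal.ofReal_le_ofReal h4

/-- The maximal inequality for `Φ`. -/
lemma wBound_Phi {y₀ y r : ℝ} (hy₀ : y₀ ∈ Ioo (0 : ℝ) 1) (hirr : Irrational y₀)
    (hy : y ∈ Icc (0 : ℝ) 1) (hr : r ∈ Icc (0 : ℝ) 1) :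
    WBound Phi (ENNReal.ofReal 2056 *
      (truncPhi (Real.log (1 / |y - y₀|)) y₀ + ENNReal.ofReal (2 + y₀))) y₀ y r :=
  lintegral_mul_Phi_le (Measurable.ennreal_ofReal (by fun_prop))
    fun K => wBound_head K hy₀ hirr hy hr

lemma WBound.unweighted {f : ℝ → ℝ≥0∞} {A : ℝ≥0∞} {y₀ y : ℝ} (h : WBound f A y₀ y 0) :
    ∫⁻ t in uIoo y₀ y, f t ≤ A * ENNReal.ofReal |y - y₀| := by
  simpa [WBound] using h

/-- Local bounds for the tails of `Φ` near an irrational point. -/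
lemma eventually_wBound_tail (K : ℕ) {y₀ : ℝ} (hy₀ : y₀ ∈ Ioo (0 : ℝ) 1) (hirr : Irrational y₀) :
    ∀ᶠ y in 𝓝 y₀, ∀ r ∈ Icc (0 : ℝ) 1, WBound (tail K)
      (ENNReal.ofReal 2056 * (tail K y₀ + ENNReal.ofReal (3 * beta K y₀))) y₀ y r := by
  induction K generalizing y₀ with
  | zero =>
    filter_upwards [Ioo_mem_nhds hy₀.1 hy₀.2] with y hy r hr
    refine (wBound_Phi hy₀ hirr ⟨hy.1.le, hy.2.le⟩ hr).mono ?_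
    rw [tail_zero, beta_zero]
    exact mul_le_mul_right (add_le_add (truncPhi_le_Phi hy₀.1.le)
      (ENNReal.ofReal_le_ofReal (by linarith [hy₀.2]))) _
  | succ K ih =>
    set n := ⌊1 / y₀⌋₊ with hn
    have hn1 : 1 ≤ n := Nat.le_floor (by
      rw [Nat.cast_one, le_div_iff₀ hy₀.1]; linarith [hy₀.2])
    have hn1' : (1 : ℝ) ≤ n := by exact_mod_cast hn1
    have e₀ : y₀ = 1 / (n + gauss y₀) := eq_inv_floor_add_gauss hy₀.1
    have hg := gauss_mem_Ioo hirr
    have hgn : gauss y₀ = 1 / y₀ - n := by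
      conv_rhs => rw [e₀]
      simp
    -- Near y₀ the point y stays in the branch n, so the neighbourhood from the induction hypothesis
    -- can be pulled back. It depends on K, but the bound there is uniform in r, which changes at
    -- each level.
    have hcont : Tendsto (fun y : ℝ => 1 / y - n) (𝓝 y₀) (𝓝 (gauss y₀)) := by
      rw [hgn]
      exact (tendsto_const_nhds.div tendsto_id hy₀.1.ne').sub_const _
    filter_upwards [Ioo_mem_nhds hy₀.1 hy₀.2, hcont (Ioo_mem_nhds hg.1 hg.2),
      hcont.eventually (ih hg (gauss_irrational hirr))] with y hy hy1 hy2 r hr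
    have e : y = 1 / (n + (1 / y - n)) := by simp
    have h2 := WBound.transfer hn1 ⟨hg.1.le, hg.2⟩ ⟨hy1.1.le, hy1.2⟩ hr.1
      (hy2 (1 / (n + r)) ⟨by have := hr.1; positivity, by
          rw [div_le_one (by linarith [hr.1])]; linarith [hr.1]⟩)
    rw [← e₀, ← e] at h2
    refine (h2.congr fun t ht => tail_succ ((le_min hy₀.1.le hy.1.le).trans ht.1.le) K).mono
      (le_of_eq ?_)
    rw [tail_succ hy₀.1.le, beta_succ, Brjuno.transfer, mul_left_comm 3, ENNReal.ofReal_mul hy₀.1.le]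
    ring

/-! ### Increments of Ψ and the derivative at irrational points -/

lemma lintegral_Phi_ne_top {s : Set ℝ} (hs : s ⊆ Icc 0 1) : ∫⁻ t in s, Phi t ≠ ∞ := by
  refine ne_top_of_le_ne_top (ENNReal.ofReal_ne_top (r := 6)) ((lintegral_mono_set hs).trans ?_)
  rw [← setLIntegral_congr Ioc_ae_eq_Icc]
  exact lintegral_Phi_Ioc_le

lemma Psi_sub_of_le {x y : ℝ} (hx : 0 ≤ x) (hxy : x ≤ y) (hy : y ≤ 1) :
    Psi y - Psi x = (∫⁻ t in Ioo x y, Phi t).toReal := by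
  have h : ∫⁻ t in Icc 0 y, Phi t = (∫⁻ t in Icc 0 x, Phi t) + ∫⁻ t in Ioo x y, Phi t := by
    rw [setLIntegral_congr (Ioo_ae_eq_Ioc (a := x) (b := y)), ← Icc_union_Ioc_eq_Icc hx hxy]
    refine lintegral_union measurableSet_Ioc ?_
    exact Set.disjoint_left.2 fun t h1 h2 => absurd h1.2 (not_le.2 h2.1)
  unfold Psi
  rw [h, ENNReal.toReal_add]
  · ring
  · exact lintegral_Phi_ne_top (Icc_subset_Icc_right (hxy.trans hy))
  · exact lintegral_Phi_ne_top fun t ht => ⟨hx.trans ht.1.le, ht.2.le.trans hy⟩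

lemma uIoo_subset_Icc {x y : ℝ} (hx : x ∈ Icc (0 : ℝ) 1) (hy : y ∈ Icc (0 : ℝ) 1) :
    uIoo x y ⊆ Icc 0 1 := fun _ ht =>
  ⟨(le_min hx.1 hy.1).trans ht.1.le, ht.2.le.trans (max_le hx.2 hy.2)⟩

lemma abs_Psi_sub {x y : ℝ} (hx : x ∈ Icc (0 : ℝ) 1) (hy : y ∈ Icc (0 : ℝ) 1) :
    |Psi y - Psi x| = (∫⁻ t in uIoo x y, Phi t).toReal := by
  rcases le_total x y with h | h
  · rw [uIoo_of_le h, Psi_sub_of_le hx.1 h hy.2, abs_of_nonneg ENNReal.toReal_nonneg]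
  · rw [uIoo_of_ge h, abs_sub_comm, Psi_sub_of_le hy.1 h hx.2, abs_of_nonneg ENNReal.toReal_nonneg]

lemma Psi_sub_div {x h : ℝ} (hx : x ∈ Icc (0 : ℝ) 1) (hy : x + h ∈ Icc (0 : ℝ) 1) :
    (Psi (x + h) - Psi x) / h = (∫⁻ t in uIoo x (x + h), Phi t).toReal / |h| := by
  rcases le_total 0 h with h0 | h0
  · rw [uIoo_of_le (by linarith), Psi_sub_of_le hx.1 (by linarith) hy.2, abs_of_nonneg h0]
  · rw [uIoo_of_ge (by linarith), ← neg_sub, Psi_sub_of_le hy.1 (by linarith) hx.2,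
      abs_of_nonpos h0, neg_div, div_neg]

lemma continuousAt_gauss {x : ℝ} (hx : Irrational x) : ContinuousAt gauss x := by
  have h1 : ContinuousAt (fun y : ℝ => Int.fract (1 / y)) x := by
    refine ContinuousAt.comp (f := fun y : ℝ => 1 / y) (g := Int.fract) ?_
      (continuousAt_const.div continuousAt_id hx.ne_zero)
    refine continuousAt_fract ?_
    have := (gauss_irrational hx).ne_zero
    rw [gauss_of_ne_zero hx.ne_zero] at this
    exact fun h => this (sub_eq_zero.2 h)
  refine h1.congr ?_
  filter_upwards [isOpen_ne.mem_nhds hx.ne_zero] with y hy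
  exact (gauss_of_ne_zero hy).symm

lemma continuousAt_alpha (k : ℕ) {x : ℝ} (hx : Irrational x) : ContinuousAt (alpha k) x := by
  induction k with
  | zero => exact continuousAt_id
  | succ k ih =>
    have : alpha (k + 1) = gauss ∘ alpha k := funext fun y => alpha_succ k y
    rw [this]
    exact (continuousAt_gauss (alpha_irrational hx k)).comp ih

lemma continuousAt_gammaTerm (k : ℕ) {x : ℝ} (hx : Irrational x) :
    ContinuousAt (gammaTerm k) x := by
  have : gammaTerm k = fun y => beta k y * Real.log (1 / alpha k y) := funext (gammaTerm_eq k)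
  have hne := (alpha_irrational hx k).ne_zero
  rw [this]
  refine ContinuousAt.mul (tendsto_finsetProd _ fun j _ => continuousAt_alpha j hx) ?_
  exact (continuousAt_const.div (continuousAt_alpha k hx) hne).log (one_div_ne_zero hne)

/-- The partial sums of `Φ` as a real function. -/
def headReal (K : ℕ) (x : ℝ) : ℝ := ∑ k ∈ Finset.range K, gammaTerm k x

lemma head_eq_ofReal (K : ℕ) {x : ℝ} (hx : x ∈ Icc (0 : ℝ) 1) :
    head K x = ENNReal.ofReal (headReal K x) :=
  (ENNReal.ofReal_sum_of_nonneg fun k _ => gammaTerm_nonneg hx.1 hx.2 k).symm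

lemma headReal_nonneg (K : ℕ) {x : ℝ} (hx : x ∈ Icc (0 : ℝ) 1) : 0 ≤ headReal K x :=
  Finset.sum_nonneg fun k _ => gammaTerm_nonneg hx.1 hx.2 k

lemma continuousAt_headReal (K : ℕ) {x : ℝ} (hx : Irrational x) : ContinuousAt (headReal K) x :=
  tendsto_finsetSum _ fun k _ => continuousAt_gammaTerm k hx

lemma eventually_forall_uIoo {x₀ : ℝ} {p : ℝ → Prop} (hp : ∀ᶠ t in 𝓝 x₀, p t) :
    ∀ᶠ y in 𝓝 x₀, ∀ t ∈ uIoo x₀ y, p t := by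
  obtain ⟨ε, hε, h⟩ := Metric.eventually_nhds_iff_ball.1 hp
  refine Metric.eventually_nhds_iff_ball.2 ⟨ε, hε, fun y hy t ht => h t ?_⟩
  rw [Metric.mem_ball, Real.dist_eq, abs_lt] at *
  rcases le_total x₀ y with h' | h'
  · rw [uIoo_of_le h'] at ht; constructor <;> linarith [ht.1, ht.2]
  · rw [uIoo_of_ge h'] at ht; constructor <;> linarith [ht.1, ht.2]

lemma tendsto_add_nhdsNE (x₀ : ℝ) : Tendsto (fun h : ℝ => x₀ + h) (𝓝[≠] 0) (𝓝 x₀) := by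
  have : Tendsto (fun h : ℝ => x₀ + h) (𝓝 0) (𝓝 (x₀ + 0)) := tendsto_const_nhds.add tendsto_id
  rw [add_zero] at this
  exact this.mono_left nhdsWithin_le_nhds

/-- Φ dominates its partial sums, which are continuous at x₀ and exceed a there once K is large.
Finiteness of Φ(x₀) plays no role, so Cremer numbers are covered. -/
lemma eventually_lt_mean {x₀ : ℝ} (hx₀ : x₀ ∈ Ioo (0 : ℝ) 1) (hirr : Irrational x₀) {a : ℝ}
    (ha : (a : EReal) < ((Phi x₀ : ℝ≥0∞) : EReal)) :
    ∀ᶠ h in 𝓝[≠] (0 : ℝ), a < (Psi (x₀ + h) - Psi x₀) / h := by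
  have hIcc : x₀ ∈ Icc (0 : ℝ) 1 := ⟨hx₀.1.le, hx₀.2.le⟩
  obtain ⟨K, hK⟩ : ∃ K, a < headReal K x₀ := by
    rcases lt_or_ge a 0 with h | h
    · exact ⟨0, by simpa [headReal] using h⟩
    · have h1 : ENNReal.ofReal a < Phi x₀ := by
        rw [← EReal.coe_ennreal_lt_coe_ennreal_iff, EReal.coe_ennreal_ofReal, max_eq_left h]
        exact ha
      obtain ⟨K, hK⟩ := ((tendsto_head x₀).eventually (lt_mem_nhds h1)).exists
      rw [head_eq_ofReal K hIcc] at hK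
      exact ⟨K, (ENNReal.ofReal_lt_ofReal_iff_of_nonneg h).1 hK⟩
  obtain ⟨b, hab, hbK⟩ := exists_between hK
  have h1 := (tendsto_add_nhdsNE x₀).eventually (eventually_forall_uIoo
    ((continuousAt_headReal K hirr).eventually (lt_mem_nhds hbK)))
  filter_upwards [h1, (tendsto_add_nhdsNE x₀).eventually (Ioo_mem_nhds hx₀.1 hx₀.2),
    self_mem_nhdsWithin] with h h1 h2 hne
  have h2' : x₀ + h ∈ Icc (0 : ℝ) 1 := ⟨h2.1.le, h2.2.le⟩
  have hpos : 0 < |h| := abs_pos.2 hne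
  rw [Psi_sub_div hIcc h2', lt_div_iff₀ hpos]
  have h3 : ENNReal.ofReal (b * |h|) ≤ ∫⁻ t in uIoo x₀ (x₀ + h), Phi t := by
    rw [ENNReal.ofReal_mul' hpos.le]
    have : ENNReal.ofReal |h| = volume (uIoo x₀ (x₀ + h)) := by
      rw [Real.volume_uIoo, add_sub_cancel_left]
    rw [this, ← setLIntegral_const]
    refine setLIntegral_mono' measurableSet_uIoo fun t ht => ?_
    refine le_trans ?_ (head_le_Phi K t)
    rw [head_eq_ofReal K (uIoo_subset_Icc hIcc h2' ht)]
    exact ENNReal.ofReal_le_ofReal (h1 t ht).le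
  have h4 := (ENNReal.ofReal_le_iff_le_toReal
    (lintegral_Phi_ne_top (uIoo_subset_Icc hIcc h2'))).1 h3
  nlinarith

/-- A partial sum is continuous and stays below c > Φ(x₀); the mean of the tail is at most a
constant times the tail at x₀ plus 3 β_K(x₀), small for large K. -/
lemma eventually_mean_lt {x₀ : ℝ} (hx₀ : x₀ ∈ Ioo (0 : ℝ) 1) (hirr : Irrational x₀)
    (hfin : Phi x₀ ≠ ∞) {b : ℝ} (hb : (Phi x₀).toReal < b) :
    ∀ᶠ h in 𝓝[≠] (0 : ℝ), (Psi (x₀ + h) - Psi x₀) / h < b := by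
  have hIcc : x₀ ∈ Icc (0 : ℝ) 1 := ⟨hx₀.1.le, hx₀.2.le⟩
  obtain ⟨c, hac, hcb⟩ := exists_between hb
  have ht : Tendsto (fun K => ENNReal.ofReal 2056 *
      (tail K x₀ + ENNReal.ofReal (3 * beta K x₀))) atTop (𝓝 0) := by
    have t1 : Tendsto (fun K => tail K x₀) atTop (𝓝 0) := ENNReal.tendsto_sum_nat_add _ hfin
    have t2 : Tendsto (fun K => ENNReal.ofReal (3 * beta K x₀)) atTop (𝓝 0) := by
      have := (summable_beta hIcc.1 hIcc.2).tendsto_atTop_zero.const_mul 3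
      rw [mul_zero] at this
      simpa using ENNReal.tendsto_ofReal this
    have := ENNReal.Tendsto.const_mul (t1.add t2) (Or.inr (ENNReal.ofReal_ne_top (r := 2056)))
    simpa using this
  obtain ⟨K, hK⟩ := (ht.eventually (gt_mem_nhds
    (ENNReal.ofReal_pos.2 (sub_pos.2 hcb)))).exists
  have hKc : headReal K x₀ < c := by
    refine lt_of_le_of_lt ?_ hac
    refine (ENNReal.ofReal_le_iff_le_toReal hfin).1 ?_
    rw [← head_eq_ofReal K hIcc]
    exact head_le_Phi K x₀
  have h1 := (tendsto_add_nhdsNE x₀).eventually (eventually_forall_uIoo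
    ((continuousAt_headReal K hirr).eventually (gt_mem_nhds hKc)))
  have h2 := (tendsto_add_nhdsNE x₀).eventually (eventually_wBound_tail K hx₀ hirr)
  filter_upwards [h1, h2, (tendsto_add_nhdsNE x₀).eventually (Ioo_mem_nhds hx₀.1 hx₀.2),
    self_mem_nhdsWithin] with h h1 h2 h3 hne
  have h3' : x₀ + h ∈ Icc (0 : ℝ) 1 := ⟨h3.1.le, h3.2.le⟩
  have hpos : 0 < |h| := abs_pos.2 hne
  have hc0 : 0 ≤ c := ENNReal.toReal_nonneg.trans hac.le
  set A := ENNReal.ofReal 2056 * (tail K x₀ + ENNReal.ofReal (3 * beta K x₀)) with hA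
  have hAfin : A ≠ ∞ := hK.ne_top
  have h4 := (h2 0 ⟨le_rfl, zero_le_one⟩).unweighted
  rw [add_sub_cancel_left] at h4
  have h5 : ∫⁻ t in uIoo x₀ (x₀ + h), Phi t ≤ ENNReal.ofReal ((c + A.toReal) * |h|) := by
    rw [ENNReal.ofReal_mul' hpos.le, ENNReal.ofReal_add hc0 ENNReal.toReal_nonneg,
      ENNReal.ofReal_toReal hAfin, add_mul]
    simp only [Phi_eq_head_add_tail K]
    rw [lintegral_add_right _ (measurable_tail K)]
    refine add_le_add ?_ h4
    have : ENNReal.ofReal |h| = volume (uIoo x₀ (x₀ + h)) := by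
      rw [Real.volume_uIoo, add_sub_cancel_left]
    rw [this, ← setLIntegral_const]
    refine setLIntegral_mono' measurableSet_uIoo fun t ht => ?_
    rw [head_eq_ofReal K (uIoo_subset_Icc hIcc h3' ht)]
    exact ENNReal.ofReal_le_ofReal (h1 t ht).le
  have hA2 : A.toReal < b - c := (ENNReal.lt_ofReal_iff_toReal_lt hAfin).1 hK
  rw [Psi_sub_div hIcc h3', div_lt_iff₀ hpos]
  have h6 := ENNReal.toReal_le_of_le_ofReal (by positivity) h5
  refine h6.trans_lt ?_
  exact mul_lt_mul_of_pos_right (by linarith) hpos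

theorem tendsto_mean {x₀ : ℝ} (hx₀ : x₀ ∈ Ioo (0 : ℝ) 1) (hirr : Irrational x₀) :
    Tendsto (fun h : ℝ => (((Psi (x₀ + h) - Psi x₀) / h : ℝ) : EReal))
        (𝓝[≠] 0) (𝓝 ((Phi x₀ : ℝ≥0∞) : EReal)) := by
  by_cases hfin : Phi x₀ = ∞
  · rw [hfin, EReal.coe_ennreal_top, EReal.tendsto_nhds_top_iff_real]
    intro a
    have := eventually_lt_mean hx₀ hirr (a := a) (by rw [hfin]; exact EReal.coe_lt_top a)
    simpa only [EReal.coe_lt_coe_iff] using this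
  · have hcoe : ((Phi x₀ : ℝ≥0∞) : EReal) = (((Phi x₀).toReal : ℝ) : EReal) :=
      (EReal.coe_ennreal_toReal hfin).symm
    rw [hcoe, EReal.tendsto_coe]
    refine tendsto_order.2 ⟨fun a ha => eventually_lt_mean hx₀ hirr ?_,
      fun b hb => eventually_mean_lt hx₀ hirr hfin hb⟩
    rw [hcoe]; exact EReal.coe_lt_coe_iff.2 ha

/-! ### The bound o(h log(1/|h|)) -/

/-- The first K terms are bounded independently of L; the others are at most L ∑_{k ≥ K} β_k, and
that sum is below ε for suitable K. -/
lemma truncPhi_le_add {x : ℝ} (hx : x ∈ Icc (0 : ℝ) 1) {ε : ℝ} (hε : 0 < ε) :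
    ∃ M : ℝ, ∀ L : ℝ, 0 ≤ L → truncPhi L x ≤ ENNReal.ofReal (M + ε * L) := by
  have hsum : ∑' k, ENNReal.ofReal (beta k x) ≠ ∞ := by
    rw [← ENNReal.ofReal_tsum_of_nonneg (fun k => beta_nonneg hx.1 k) (summable_beta hx.1 hx.2)]
    exact ENNReal.ofReal_ne_top
  obtain ⟨K, hK⟩ := ((ENNReal.tendsto_sum_nat_add _ hsum).eventually
    (gt_mem_nhds (ENNReal.ofReal_pos.2 hε))).exists
  refine ⟨headReal K x, fun L hL => ?_⟩
  rw [ENNReal.ofReal_add (headReal_nonneg K hx) (by positivity), ← head_eq_ofReal K hx,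
    ENNReal.ofReal_mul hε.le, truncPhi, ← ENNReal.summable.sum_add_tsum_nat_add' (k := K)]
  refine add_le_add (Finset.sum_le_sum fun k _ => ENNReal.ofReal_le_ofReal ?_) ?_
  · rw [gammaTerm_eq]; exact mul_le_mul_of_nonneg_left (min_le_left _ _) (beta_nonneg hx.1 k)
  · refine le_trans ?_ (mul_le_mul_left hK.le _)
    rw [← ENNReal.tsum_mul_right]
    refine ENNReal.tsum_le_tsum fun k => ?_
    rw [← ENNReal.ofReal_mul (beta_nonneg hx.1 _)]
    exact ENNReal.ofReal_le_ofReal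
      (mul_le_mul_of_nonneg_left (min_le_right _ _) (beta_nonneg hx.1 _))

theorem isLittleO_Psi {x₀ : ℝ} (hx₀ : x₀ ∈ Ioo (0 : ℝ) 1) (hirr : Irrational x₀) :
    (fun h : ℝ => Psi (x₀ + h) - Psi x₀)
        =o[𝓝[≠] 0] (fun h : ℝ => h * Real.log (1 / |h|)) := by
  have hIcc : x₀ ∈ Icc (0 : ℝ) 1 := ⟨hx₀.1.le, hx₀.2.le⟩
  refine isLittleO_iff.2 fun c hc => ?_
  -- As 4112 = 2 · 2056, the truncated sum uses half of c log(1/|h|), and the bounded terms fit in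
  -- the other half for small h.
  obtain ⟨M, hM⟩ := truncPhi_le_add hIcc (ε := c / 4112) (by positivity)
  have hlim : Tendsto (fun h : ℝ => Real.log (1 / |h|)) (𝓝[≠] 0) atTop := by
    simp only [one_div, Real.log_inv, Real.log_abs]
    exact tendsto_neg_atBot_atTop.comp Real.tendsto_log_nhdsNE_zero
  filter_upwards [hlim.eventually_ge_atTop 0, hlim.eventually_ge_atTop (4112 * (|M| + 3) / c),
    (tendsto_add_nhdsNE x₀).eventually (Ioo_mem_nhds hx₀.1 hx₀.2)] with h hL0 hL h3
  have h3' : x₀ + h ∈ Icc (0 : ℝ) 1 := ⟨h3.1.le, h3.2.le⟩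
  have hb := (wBound_Phi hx₀ hirr h3' ⟨le_rfl, zero_le_one⟩).unweighted
  rw [add_sub_cancel_left] at hb
  set L := Real.log (1 / |h|)
  rw [Real.norm_eq_abs, Real.norm_eq_abs, abs_Psi_sub hIcc h3', abs_mul, abs_of_nonneg hL0]
  have h4 : ∫⁻ t in uIoo x₀ (x₀ + h), Phi t ≤
      ENNReal.ofReal (2056 * (|M| + c / 4112 * L + (2 + x₀)) * |h|) := by
    rw [ENNReal.ofReal_mul' (abs_nonneg h), ENNReal.ofReal_mul (by norm_num),
      ENNReal.ofReal_add (by positivity) (by linarith [hx₀.1])]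
    refine hb.trans (mul_le_mul_left (mul_le_mul_right (add_le_add ((hM L hL0).trans ?_) le_rfl) _) _)
    exact ENNReal.ofReal_le_ofReal (by linarith [le_abs_self M])
  have h5 := ENNReal.toReal_le_of_le_ofReal (mul_nonneg (mul_nonneg (by norm_num)
    (add_nonneg (by positivity) (by linarith [hx₀.1]))) (abs_nonneg h)) h4
  refine h5.trans ?_
  rw [mul_left_comm, mul_comm |h|]
  rw [div_le_iff₀ hc] at hL
  have h6 : 2056 * (|M| + c / 4112 * L + (2 + x₀)) ≤ c * L := by
    linarith [hx₀.2]
  calc _ ≤ c * L * |h| := mul_le_mul_of_nonneg_right h6 (abs_nonneg h)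
    _ = _ := by ring

/-! ### Local models of Φ at rational points -/

lemma gauss_natCast_div {p q : ℕ} (hp : 0 < p) (hq : 0 < q) :
    gauss ((p : ℝ) / q) = ((q % p : ℕ) : ℝ) / p := by
  rw [gauss_of_ne_zero (by positivity), one_div_div, Int.fract_div_natCast_eq_div_natCast_mod]

lemma Phi_natCast_div_le_log (p q : ℕ) (hq : 0 < q) (hpq : p ≤ q) :
    Phi ((p : ℝ) / q) ≤ ENNReal.ofReal (Real.log q) := by
  induction p using Nat.strong_induction_on generalizing q with
  | _ p ih =>
    rcases Nat.eq_zero_or_pos p with rfl | hp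
    · simp [Phi_zero]
    have hp' : (1 : ℝ) ≤ p := by exact_mod_cast hp
    have hq' : (0 : ℝ) < q := by exact_mod_cast hq
    have hpq' : (p : ℝ) ≤ q := by exact_mod_cast hpq
    have hm := Nat.mod_lt q hp
    rw [Phi_eq (by positivity), transfer, gauss_natCast_div hp hq]
    have h1 : ENNReal.ofReal ((p : ℝ) / q) * Phi (((q % p : ℕ) : ℝ) / p)
        ≤ ENNReal.ofReal (Real.log p) := by
      refine le_trans (mul_le_of_le_one_left zero_le ?_) (ih _ hm p hp hm.le)
      exact ENNReal.ofReal_le_one.2 ((div_le_one hq').2 hpq')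
    refine (add_le_add le_rfl h1).trans_eq ?_
    have h2 : 0 ≤ Real.log (1 / ((p : ℝ) / q)) :=
      Real.log_nonneg (by rw [one_div_div, le_div_iff₀ (by positivity)]; linarith)
    rw [← ENNReal.ofReal_add h2 (Real.log_nonneg hp'), one_div_div,
      Real.log_div hq'.ne' (by positivity)]
    congr 1; ring

/-- Near `p/q` the function `Φ` looks like `Φ(p/q) + Φ(s)/(q + s q')` in the coordinate `s` with
`x = (p + s p')/(q + s q')`. -/
structure LocalModel (p q p' q' K : ℝ) : Prop where
  nonneg : 0 ≤ q'
  le : 2 * q' ≤ q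
  det : |p' * q - p * q'| = 1
  ne_top : ∀ s ∈ Ioo (-1 : ℝ) 1, Per s ≠ ∞ → Per ((p + s * p') / (q + s * q')) ≠ ∞
  bound : ∀ s ∈ Ioo (-1 : ℝ) 1, Per s ≠ ∞ →
    |(Per ((p + s * p') / (q + s * q'))).toReal - (Phi (p / q)).toReal
      - (Per s).toReal / (q + s * q')| ≤ K * |s| / (q + s * q')

lemma localModel_zero : LocalModel 0 1 1 0 0 := by
  constructor <;> simp [Phi_zero]

/-- A separate starting point: reaching 1/1 from 0/1 by `LocalModel.step` would give q' = q = 1,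
against 2q' ≤ q. -/
lemma localModel_one : LocalModel 1 1 1 0 0 := by
  have h : ∀ s, Per (1 + s) = Per s := fun s => by
    simpa using Per_add_natCast 1 s
  constructor <;> simp [Phi_one, h]

lemma add_mul_bounds {q q' s : ℝ} (h0 : 0 ≤ q') (h : 2 * q' ≤ q)
    (hs : s ∈ Ioo (-1 : ℝ) 1) : q / 2 ≤ q + s * q' ∧ q + s * q' ≤ 3 / 2 * q := by
  have h1 := hs.1
  have h2 := hs.2
  constructor <;> nlinarith

/-- One step of the Euclidean algorithm, obtained by subtracting the functional equations at x and
at p/q. Multiplication by x turns the denominator p + s p' into q + s q' exactly, so the old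
constant K is kept. As |x - p/q| = |s|/((q + s q') q), the difference of logarithms adds 3/p and the
term (x - p/q) Φ(r/p) adds (log p)/q. The hypothesis `hle` gives x ≤ 1, where `Per` satisfies the
functional equation. -/
lemma LocalModel.step {r p r' p' K : ℝ} (h : LocalModel r p r' p' K) {n : ℕ} (hn : 1 ≤ n)
    (hp : 1 ≤ p) (hr0 : 0 ≤ r) (hrp : r < p) (hr' : 0 ≤ r')
    (hq' : 2 * (n * p' + r') ≤ n * p + r)
    (hle : ∀ s ∈ Ioo (-1 : ℝ) 1, p + s * p' ≤ (n * p + r) + s * (n * p' + r'))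
    (hfin : Phi (r / p) ≤ ENNReal.ofReal (Real.log p)) :
    LocalModel p (n * p + r) p' (n * p' + r') (K + (3 / p + Real.log p / (n * p + r))) := by
  obtain ⟨hp'0, hp'p, hdet, hne, hb⟩ := h
  have hn' : (1 : ℝ) ≤ n := by exact_mod_cast hn
  have hp0 : 0 < p := by linarith
  set q := n * p + r with hqdef
  set q' := n * p' + r' with hq'def
  have hq0 : 0 < q := by positivity
  have hpq : p ≤ q := by nlinarith
  have hq'0 : 0 ≤ q' := by positivity
  have hlogp : 0 ≤ Real.log p := Real.log_nonneg hp
  have hfin' : Phi (r / p) ≠ ∞ := ne_top_of_le_ne_top ENNReal.ofReal_ne_top hfin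
  have hfinlog : (Phi (r / p)).toReal ≤ Real.log p := ENNReal.toReal_le_of_le_ofReal hlogp hfin
  -- the functional equation at `x` and at `p / q`
  have hfe : ∀ s ∈ Ioo (-1 : ℝ) 1, Per ((p + s * p') / (q + s * q')) =
      ENNReal.ofReal (Real.log (1 / ((p + s * p') / (q + s * q')))) +
        ENNReal.ofReal ((p + s * p') / (q + s * q')) * Per ((r + s * r') / (p + s * p')) := by
    intro s hs
    obtain ⟨a1, -⟩ := add_mul_bounds hp'0 hp'p hs
    obtain ⟨b1, -⟩ := add_mul_bounds hq'0 hq' hs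
    have a0 : 0 < p + s * p' := by linarith
    have b0 : 0 < q + s * q' := by linarith
    rw [Per_of_pos (by positivity) ((div_le_one b0).2 (hle s hs))]
    congr 2
    rw [← Per_add_natCast n ((r + s * r') / (p + s * p')), one_div_div]
    congr 1
    rw [eq_comm, add_div' _ _ _ a0.ne', hqdef, hq'def]
    congr 1; ring
  have hfe0 : Phi (p / q) = ENNReal.ofReal (Real.log (1 / (p / q))) +
      ENNReal.ofReal (p / q) * Phi (r / p) := by
    rw [Phi_eq (by positivity), transfer, gauss_of_ne_zero (by positivity)]
    congr 3
    have : 1 / (p / q) = n + r / p := by rw [one_div_div, hqdef]; field_simp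
    rw [this, Int.fract_natCast_add, Int.fract_eq_self]
    exact ⟨by positivity, (div_lt_one hp0).2 hrp⟩
  have hfe0R : (Phi (p / q)).toReal = Real.log (1 / (p / q)) + p / q * (Phi (r / p)).toReal := by
    rw [hfe0, ENNReal.toReal_add ENNReal.ofReal_ne_top
      (ENNReal.mul_ne_top ENNReal.ofReal_ne_top hfin'), ENNReal.toReal_mul,
      ENNReal.toReal_ofReal (Real.log_nonneg (by rw [one_div_div, le_div_iff₀ hp0]; linarith)),
      ENNReal.toReal_ofReal (by positivity)]
  have hdet' : |p' * q - p * q'| = 1 := by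
    rw [← hdet, hqdef, hq'def, abs_sub_comm]
    congr 1; ring
  refine ⟨hq'0, hq', hdet', fun s hs hPs => ?_, fun s hs hPs => ?_⟩
  · rw [hfe s hs]
    exact ENNReal.add_ne_top.2 ⟨ENNReal.ofReal_ne_top,
      ENNReal.mul_ne_top ENNReal.ofReal_ne_top (hne s hs hPs)⟩
  · obtain ⟨a1, a2⟩ := add_mul_bounds hp'0 hp'p hs
    obtain ⟨b1, b2⟩ := add_mul_bounds hq'0 hq' hs
    have a0 : 0 < p + s * p' := by linarith
    have b0 : 0 < q + s * q' := by linarith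
    have hbs := hb s hs hPs
    set x := (p + s * p') / (q + s * q') with hx
    have hx0 : 0 < x := by positivity
    have hfeR : (Per x).toReal = Real.log (1 / x) +
        x * (Per ((r + s * r') / (p + s * p'))).toReal := by
      rw [hfe s hs, ENNReal.toReal_add ENNReal.ofReal_ne_top
        (ENNReal.mul_ne_top ENNReal.ofReal_ne_top (hne s hs hPs)), ENNReal.toReal_mul,
        ENNReal.toReal_ofReal (Real.log_nonneg (by
          rw [le_div_iff₀ hx0, one_mul]; exact (div_le_one b0).2 (hle s hs))),
        ENNReal.toReal_ofReal hx0.le]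
    set Y := (Per ((r + s * r') / (p + s * p'))).toReal
    set P := (Per s).toReal
    set F := (Phi (r / p)).toReal
    have hF0 : 0 ≤ F := ENNReal.toReal_nonneg
    set D := |s| / (q + s * q') with hD
    have hD0 : 0 ≤ D := by positivity
    have hdiff : |x - p / q| = D / q := by
      have : x - p / q = s * (p' * q - p * q') / ((q + s * q') * q) := by
        rw [hx, div_sub_div _ _ b0.ne' hq0.ne']; congr 1; ring
      rw [this, abs_div, abs_mul, hdet', mul_one, abs_of_pos (mul_pos b0 hq0), hD, div_div]
    have hlog : |Real.log (1 / x) - Real.log (1 / (p / q))| ≤ 3 / p * D := by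
      have e : Real.log (1 / x) - Real.log (1 / (p / q)) = Real.log (p / q) - Real.log x := by
        rw [one_div, one_div, Real.log_inv, Real.log_inv]; ring
      rw [e]
      have hpq0 : 0 < p / q := by positivity
      have u1 : Real.log x - Real.log (p / q) ≤ |x - p / q| / (p / q) := by
        rw [← Real.log_div hx0.ne' hpq0.ne']
        refine (Real.log_le_sub_one_of_pos (by positivity)).trans ?_
        rw [div_sub_one hpq0.ne']
        gcongr
        exact le_abs_self _
      have u2 : Real.log (p / q) - Real.log x ≤ |x - p / q| / x := by
        rw [← Real.log_div hpq0.ne' hx0.ne']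
        refine (Real.log_le_sub_one_of_pos (by positivity)).trans ?_
        rw [div_sub_one hx0.ne', abs_sub_comm]
        gcongr
        exact le_abs_self _
      have v1 : |x - p / q| / (p / q) = 1 / p * D := by rw [hdiff]; field_simp
      have v2 : |x - p / q| / x ≤ 3 / p * D := by
        rw [hdiff, div_div, mul_comm (3 / p), div_eq_mul_one_div D]
        refine mul_le_mul_of_nonneg_left ?_ hD0
        have : p / 3 ≤ q * x := by
          rw [hx, mul_div_assoc', le_div_iff₀ b0]
          have t1 : q * (p / 2) ≤ q * (p + s * p') := mul_le_mul_of_nonneg_left a1 hq0.le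
          have t2 : p / 3 * (q + s * q') ≤ p / 3 * (3 / 2 * q) :=
            mul_le_mul_of_nonneg_left b2 (by positivity)
          linarith
        rw [div_le_div_iff₀ (by positivity) hp0]
        linarith
      have v3 : 1 / p * D ≤ 3 / p * D := by gcongr; norm_num
      rw [abs_le]
      constructor <;> linarith
    have hmul : |x * (Y - F - P / (p + s * p'))| ≤ K * D := by
      rw [abs_mul, abs_of_pos hx0]
      refine (mul_le_mul_of_nonneg_left hbs hx0.le).trans_eq ?_
      rw [hx, hD]; field_simp
    have hx2 : |(x - p / q) * F| ≤ Real.log p / q * D := by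
      rw [abs_mul, hdiff, abs_of_nonneg hF0]
      calc D / q * F ≤ D / q * Real.log p := by gcongr
        _ = _ := by ring
    have hP : x * (P / (p + s * p')) = P / (q + s * q') := by
      rw [hx]; field_simp
    have heq : (Per x).toReal - (Phi (p / q)).toReal - P / (q + s * q') =
        (Real.log (1 / x) - Real.log (1 / (p / q))) + (x - p / q) * F
          + x * (Y - F - P / (p + s * p')) := by
      rw [hfeR, hfe0R, ← hP]; ring
    rw [heq, mul_div_assoc]
    refine (abs_add_le _ _).trans ((add_le_add (abs_add_le _ _) le_rfl).trans ?_)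
    rw [← hD]
    linarith

lemma three_div_add_log_div_le {p q : ℝ} (hp : 1 ≤ p) (hpq : p ≤ q) :
    3 / p + Real.log p / q ≤ 5 / √p := by
  have h1 : 1 ≤ √p := Real.one_le_sqrt.2 hp
  have h2 : √p * √p = p := Real.mul_self_sqrt (by linarith)
  have h3 : Real.log p ≤ 2 * √p := by
    have : Real.log p = 2 * Real.log (√p) := by
      rw [Real.log_sqrt (by linarith)]; ring
    rw [this]
    linarith [Real.log_le_sub_one_of_pos (by linarith : 0 < √p)]
  have h4 : Real.log p / q ≤ 2 / √p := by
    have : Real.log p / q ≤ 2 * √p / p :=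
      div_le_div₀ (by positivity) h3 (by linarith) hpq
    refine this.trans_eq ?_
    rw [div_eq_div_iff (by linarith) (by linarith), mul_assoc, h2]
  have h5 : 3 / p ≤ 3 / √p := by
    refine div_le_div_of_nonneg_left (by norm_num) (by linarith) ?_
    nlinarith
  have h6 : 5 / √p = 3 / √p + 2 / √p := by ring
  linarith

/-- The increments 5/√p form an essentially geometric series. The bound on K is a potential whose
increase from the pair (r, p) to (p, q) is at least 5/√p. -/
lemma exists_localModel_of_pos (p q : ℕ) (hp : 0 < p) (hpq : p < q) (hco : Nat.Coprime p q) :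
    ∃ p' q' K : ℝ, LocalModel p q p' q' K ∧ 0 ≤ p' ∧ 2 * p' ≤ p ∧
      K ≤ 35 - 25 / 2 / √p - 35 / 2 / √q := by
  induction p using Nat.strong_induction_on generalizing q with
  | _ p ih =>
    have hp1 : (1 : ℝ) ≤ p := by exact_mod_cast hp
    have hpq' : (p : ℝ) ≤ q := by exact_mod_cast hpq.le
    have hmod := Nat.mod_lt q hp
    have hn : 1 ≤ q / p := (Nat.one_le_div_iff hp).2 hpq.le
    have hn' : (1 : ℝ) ≤ (q / p : ℕ) := by exact_mod_cast hn
    have hq : (q : ℝ) = (q / p : ℕ) * p + (q % p : ℕ) := by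
      have := Nat.div_add_mod q p
      rw [mul_comm] at this
      exact_mod_cast this.symm
    have hq0 : 0 < q := hp.trans hpq
    have hfin := Phi_natCast_div_le_log (q % p) p hp hmod.le
    have hinc := three_div_add_log_div_le hp1 hpq'
    have hrp : ((q % p : ℕ) : ℝ) < p := by exact_mod_cast hmod
    rcases Nat.eq_zero_or_pos (q % p) with hr | hr
    · have hp_one : p = 1 := by
        have := Nat.dvd_of_mod_eq_zero hr
        exact hco.eq_one_of_dvd this
      subst hp_one
      have hq2 : (2 : ℝ) ≤ q := by exact_mod_cast hpq
      -- Here p = 1 and the chart is 1/(q + s). Its constant is 3, while the potential is at least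
      -- 35 - 25/2 - 35/2 = 5.
      have hstep := localModel_zero.step (n := q) hq0 le_rfl le_rfl one_pos zero_le_one
        (by linarith) (fun s hs => by linarith [hs.1]) (by simp [Phi_zero])
      refine ⟨0, 1, _, by simpa using hstep, le_rfl, by norm_num, ?_⟩
      have : 35 / 2 / √(q : ℝ) ≤ 35 / 2 := by
        refine div_le_self (by norm_num) (Real.one_le_sqrt.2 (by linarith))
      simp
      linarith
    · have hco' : Nat.Coprime (q % p) p := by
        rw [Nat.coprime_iff_gcd_eq_one, ← Nat.gcd_rec]
        exact hco
      obtain ⟨r', p', K, hL, hr'0, hr'r, hK⟩ := ih (q % p) hmod p hr hmod hco'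
      have hr1 : (0 : ℝ) < (q % p : ℕ) := by exact_mod_cast hr
      have hp'0 := hL.nonneg
      have hp'p := hL.le
      have hstep := hL.step hn hp1 hr1.le hrp hr'0 (by nlinarith) (fun s hs => by
        obtain ⟨a1, -⟩ := add_mul_bounds hp'0 hp'p hs
        obtain ⟨b1, -⟩ := add_mul_bounds hr'0 hr'r hs
        nlinarith) hfin
      rw [← hq] at hstep
      refine ⟨p', _, _, hstep, hp'0, hp'p, ?_⟩
      have h2r : 2 * ((q % p : ℕ) : ℝ) ≤ q := by nlinarith
      -- From 2r ≤ q and 7/5 < √2; the ratio 7/5 is that of 35/2 to 25/2 in the potential.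
      have hsq : 7 / 5 * √((q % p : ℕ) : ℝ) ≤ √(q : ℝ) := by
        refine Real.le_sqrt_of_sq_le ?_
        rw [mul_pow, Real.sq_sqrt hr1.le]
        linarith
      have hsr : 0 < √((q % p : ℕ) : ℝ) := Real.sqrt_pos.2 hr1
      have h3 : 35 / 2 / √(q : ℝ) ≤ 25 / 2 / √((q % p : ℕ) : ℝ) := by
        rw [div_le_div_iff₀ (by linarith) hsr]; linarith
      have h4 : 35 / 2 / √(p : ℝ) = 5 / √(p : ℝ) + 25 / 2 / √(p : ℝ) := by ring
      linarith

theorem exists_localModel (p q : ℕ) (hq : 0 < q) (hpq : p ≤ q) (hco : Nat.Coprime p q) :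
    ∃ p' q' K : ℝ, LocalModel p q p' q' K ∧ K ≤ 35 := by
  rcases Nat.eq_zero_or_pos p with rfl | hp
  · have : q = 1 := by simpa using hco
    subst this
    exact ⟨1, 0, 0, by simpa using localModel_zero, by norm_num⟩
  rcases hpq.eq_or_lt with rfl | hlt
  · have : p = 1 := by simpa using hco
    subst this
    exact ⟨1, 0, 0, by simpa using localModel_one, by norm_num⟩
  · obtain ⟨p', q', K, h, -, -, hK⟩ := exists_localModel_of_pos p q hp hlt hco
    refine ⟨p', q', K, h, hK.trans ?_⟩
    have : 0 ≤ 25 / 2 / √(p : ℝ) := by positivity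
    have : 0 ≤ 35 / 2 / √(q : ℝ) := by positivity
    linarith

/-! ### The mean of Φ near an integer -/

/-- The reflection formula integrated. The deficit R is kept as a summand to avoid subtraction in
`ℝ≥0∞`. -/
lemma lintegral_Per_neg_near {a : ℝ} (h0 : 0 < a) (h1 : a < 1 / 2) :
    ∃ R ≤ ENNReal.ofReal (a ^ 2 * (Real.log (1 / a) + 1)),
      (∫⁻ t in Ioo (-a) 0, Per t) + R = ∫⁻ t in Ioo 0 a, Phi t := by
  have e : ∫⁻ t in Ioo (-a) 0, Per t = ∫⁻ u in Ioo 0 a, Phi (1 - u) := by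
    have := setLIntegral_neg_Ioo (a := 0) (b := a) measurable_Per
    rw [neg_zero] at this
    rw [this]
    exact setLIntegral_congr_fun measurableSet_Ioo fun u hu => Per_neg hu.1 (by linarith [hu.2])
  refine ⟨∫⁻ u in Ioo 0 a, ENNReal.ofReal (u * Real.log ((1 - u) / u)), ?_, ?_⟩
  · have h2 : ∫⁻ u in Ioo 0 a, ENNReal.ofReal (u * Real.log ((1 - u) / u)) ≤
        ∫⁻ u in Ioo 0 a, ENNReal.ofReal a * ENNReal.ofReal (Real.log (1 / u)) := by
      refine setLIntegral_mono' measurableSet_Ioo fun u hu => ?_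
      have hu1 := hu.1
      have hu2 := hu.2
      rw [← ENNReal.ofReal_mul h0.le]
      refine ENNReal.ofReal_le_ofReal (mul_le_mul hu.2.le (Real.log_le_log ?_ ?_) ?_ h0.le)
      · exact div_pos (by linarith) hu1
      · gcongr; linarith
      · exact Real.log_nonneg (by rw [le_div_iff₀ hu1]; linarith)
    refine h2.trans_eq ?_
    rw [lintegral_const_mul' _ _ ENNReal.ofReal_ne_top, lintegral_log_inv le_rfl h0.le
      (by linarith), ← ENNReal.ofReal_mul h0.le, one_div, Real.log_inv]
    congr 1
    ring
  · rw [e, ← lintegral_add_right]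
    · exact setLIntegral_congr_fun measurableSet_Ioo fun u hu =>
        Phi_one_sub_add hu.1 (by linarith [hu.2])
    · exact Measurable.ennreal_ofReal (by fun_prop)

lemma lintegral_Per_neg_le {a : ℝ} (h1 : a ≤ 1) :
    ∫⁻ t in Ioo (-a) 0, Per t ≤ ENNReal.ofReal 6 := by
  refine (lintegral_mono_set (Ioo_subset_Ioo_left (neg_le_neg h1))).trans ?_
  have h2 := setLIntegral_neg_Ioo (a := -1) (b := 0) (f := fun x => Per (-x))
    (measurable_Per.comp measurable_neg)
  have h3 : ∫⁻ x in Ioo (-1 : ℝ) 0, Per x = ∫⁻ x in Ioo (0 : ℝ) 1, Per x := by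
    simp only [neg_neg, neg_zero] at h2
    rw [← h2]
    have h4 : ∀ x ∈ Ioo (0 : ℝ) 1, Per (-x) = Per (1 - x) := fun x hx => by
      rw [Per_neg hx.1 hx.2, Per_eq_Phi ⟨by linarith [hx.2], by linarith [hx.1]⟩]
    rw [setLIntegral_congr_fun measurableSet_Ioo h4,
      ← (Measure.measurePreserving_sub_left (volume : Measure ℝ) 1).setLIntegral_comp_preimage
        measurableSet_Ioo measurable_Per]
    simp
  rw [h3, setLIntegral_congr_fun measurableSet_Ioo
    (fun x hx => Per_eq_Phi ⟨hx.1.le, hx.2.le⟩), setLIntegral_congr Ioo_ae_eq_Ioc]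
  exact lintegral_Phi_Ioc_le

lemma lintegral_Per_uIoo_ne_top {s : ℝ} (hs : s ∈ Ioo (-1 : ℝ) 1) :
    ∫⁻ t in uIoo 0 s, Per t ≠ ∞ := by
  rcases le_total 0 s with h | h
  · rw [uIoo_of_le h, setLIntegral_congr_fun measurableSet_Ioo
      fun x hx => Per_eq_Phi ⟨hx.1.le, hx.2.le.trans hs.2.le⟩]
    exact lintegral_Phi_ne_top fun x hx => ⟨hx.1.le, hx.2.le.trans hs.2.le⟩
  · rw [uIoo_of_ge h]
    have := lintegral_Per_neg_le (a := -s) (by linarith [hs.1])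
    rw [neg_neg] at this
    exact ne_top_of_le_ne_top ENNReal.ofReal_ne_top this

/-- The mean of `Φ` near `0`. -/
lemma abs_lintegral_Per_sub_le {s : ℝ} (hs : s ∈ Ioo (-1 : ℝ) 1) (hs0 : s ≠ 0) :
    |(∫⁻ t in uIoo 0 s, Per t).toReal - |s| * (Real.log (1 / |s|) + 1)| ≤
      32 * |s| ^ 2 * (Real.log (1 / |s|) + 1) := by
  have ha0 : 0 < |s| := abs_pos.2 hs0
  have ha1 : |s| < 1 := abs_lt.2 hs
  have hfin := lintegral_Per_uIoo_ne_top hs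
  have hl : 0 ≤ Real.log (1 / |s|) := Real.log_nonneg (by rw [le_div_iff₀ ha0]; linarith)
  have hT := lintegral_transfer_Phi_le ha0 ha1.le
  have hTfin := ne_top_of_le_ne_top ENNReal.ofReal_ne_top hT
  have hTR := ENNReal.toReal_le_of_le_ofReal (by positivity) hT
  have hT0 := ENNReal.toReal_nonneg (a := ∫⁻ t in Ioc 0 |s|, transfer Phi t)
  have hpos := lintegral_Phi_Ioo ha0 ha1.le
  have hposR : (∫⁻ t in Ioo 0 |s|, Phi t).toReal =
      |s| * (Real.log (1 / |s|) + 1) + (∫⁻ t in Ioc 0 |s|, transfer Phi t).toReal := by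
    rw [hpos, ENNReal.toReal_add ENNReal.ofReal_ne_top hTfin,
      ENNReal.toReal_ofReal (by positivity)]
    ring
  have hsq : 0 ≤ |s| ^ 2 * Real.log (1 / |s|) := by positivity
  rcases hs0.lt_or_gt with hneg | hp
  · have habs : |s| = -s := abs_of_neg hneg
    have hJ : uIoo 0 s = Ioo (-|s|) 0 := by rw [uIoo_of_ge hneg.le, habs, neg_neg]
    rw [hJ] at hfin ⊢
    set V := ∫⁻ t in Ioo (-|s|) 0, Per t
    rcases lt_or_ge |s| (1 / 2) with h2 | h2
    · obtain ⟨R, hR, hV⟩ := lintegral_Per_neg_near ha0 h2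
      have hRfin := ne_top_of_le_ne_top ENNReal.ofReal_ne_top hR
      have hRR := ENNReal.toReal_le_of_le_ofReal (by positivity) hR
      have hR0 := ENNReal.toReal_nonneg (a := R)
      have hVR := congrArg ENNReal.toReal hV
      rw [ENNReal.toReal_add hfin hRfin, hposR] at hVR
      rw [abs_le]
      constructor <;> nlinarith
    -- Reflection is available only for |s| < 1/2. Beyond that crude bounds suffice: the two
    -- quantities are at most 6 and 2, and the right side is at least 32/4 = 8.
    · have h6 := ENNReal.toReal_le_of_le_ofReal (by norm_num) (lintegral_Per_neg_le ha1.le)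
      have h7 : |s| * Real.log (1 / |s|) ≤ 1 := by
        have := Real.log_le_sub_one_of_pos (x := 1 / |s|) (by positivity)
        have h8 := mul_le_mul_of_nonneg_left this ha0.le
        rw [mul_sub, mul_one_div_cancel ha0.ne'] at h8
        linarith
      have h9 : 0 ≤ V.toReal := ENNReal.toReal_nonneg
      have h10 : 1 / 4 ≤ |s| ^ 2 := by nlinarith
      rw [abs_le]
      constructor <;> nlinarith
  · have habs : |s| = s := abs_of_pos hp
    have hJ : ∫⁻ t in uIoo 0 s, Per t = ∫⁻ t in Ioo 0 |s|, Phi t := by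
      rw [uIoo_of_le hp.le, habs]
      exact setLIntegral_congr_fun measurableSet_Ioo
        fun x hx => Per_eq_Phi ⟨hx.1.le, hx.2.le.trans hs.2.le⟩
    rw [hJ, hposR, abs_le]
    constructor <;> nlinarith

/-! ### Integrating the local model -/

lemma mem_uIoo_add_iff {a b t : ℝ} (hb : b ≠ 0) :
    t ∈ uIoo a (a + b) ↔ ∃ c ∈ Ioo (0 : ℝ) 1, t = a + c * b := by
  have hiff : t ∈ uIoo a (a + b) ↔ (t - a) / b ∈ Ioo (0 : ℝ) 1 := by
    rcases hb.lt_or_gt with h | h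
    · rw [uIoo_of_ge (by linarith), mem_Ioo, mem_Ioo, lt_div_iff_of_neg h, div_lt_iff_of_neg h]
      constructor <;> rintro ⟨h1, h2⟩ <;> constructor <;> linarith
    · rw [uIoo_of_le (by linarith), mem_Ioo, mem_Ioo, lt_div_iff₀ h, div_lt_iff₀ h]
      constructor <;> rintro ⟨h1, h2⟩ <;> constructor <;> linarith
  rw [hiff]
  constructor
  · intro h
    exact ⟨_, h, by field_simp; ring⟩
  · rintro ⟨c, hc, rfl⟩
    simpa [hb] using hc

/-- The chart `s ↦ (p + s p')/(q + s q')` carries the interval from `0` to `s` onto the interval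
between the images. -/
lemma image_moebius_uIoo {p q p' q' s : ℝ} (hq : 0 < q) (hs : 0 < q + s * q') (hs0 : s ≠ 0)
    (hdet : p' * q - p * q' ≠ 0) :
    (fun t => (p + t * p') / (q + t * q')) '' uIoo 0 s =
      uIoo (p / q) (p / q + ((p + s * p') / (q + s * q') - p / q)) := by
  have hsub : (p + s * p') / (q + s * q') - p / q
      = s * (p' * q - p * q') / ((q + s * q') * q) := by
    rw [div_sub_div _ _ hs.ne' hq.ne']; congr 1; ring
  have hne : (p + s * p') / (q + s * q') - p / q ≠ 0 := by
    rw [hsub]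
    exact div_ne_zero (mul_ne_zero hs0 hdet) (mul_pos hs hq).ne'
  have hpos : ∀ c ∈ Ioo (0 : ℝ) 1, 0 < q + c * s * q' := by
    intro c hc
    nlinarith [hc.1, hc.2]
  ext x
  rw [mem_uIoo_add_iff hne, mem_image]
  constructor
  · rintro ⟨t, ht, rfl⟩
    rw [← zero_add s, mem_uIoo_add_iff hs0] at ht
    obtain ⟨c, hc, rfl⟩ := ht
    rw [zero_add]
    have h1 := hpos c hc
    refine ⟨c * (q + s * q') / (q + c * s * q'), ⟨by have := hc.1; positivity, ?_⟩, ?_⟩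
    · rw [div_lt_one h1]; nlinarith [hc.1, hc.2]
    · rw [hsub]; field_simp; ring
  · rintro ⟨c, hc, rfl⟩
    have h1 : 0 < q + s * q' * (1 - c) := by nlinarith [hc.1, hc.2]
    have h2 : c * q / (q + s * q' * (1 - c)) ∈ Ioo (0 : ℝ) 1 := by
      refine ⟨by have := hc.1; positivity, ?_⟩
      rw [div_lt_one h1]; nlinarith [hc.1, hc.2]
    refine ⟨c * q / (q + s * q' * (1 - c)) * s, ?_, ?_⟩
    · rw [← zero_add s, mem_uIoo_add_iff hs0, zero_add]
      exact ⟨_, h2, by ring⟩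
    · have h3 := hpos _ h2
      have h4 : q + c * q / (q + s * q' * (1 - c)) * s * q'
          = q * (q + s * q') / (q + s * q' * (1 - c)) := by field_simp; ring
      rw [hsub, h4]
      field_simp
      ring

/-- With Q = q + t q' between q/2 and 3q/2, factor q³ - Q³; the constant is 19 = (1/2) · (1 + 3/2 +
9/4) · 8. -/
lemma abs_inv_pow_three_sub_le {q q' t : ℝ} (hq : 0 < q) (h0 : 0 ≤ q') (h : 2 * q' ≤ q)
    (ht : t ∈ Ioo (-1 : ℝ) 1) :
    ((q + t * q') ^ 3)⁻¹ ≤ 8 * (q ^ 3)⁻¹ ∧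
      |((q + t * q') ^ 3)⁻¹ - (q ^ 3)⁻¹| ≤ 19 * |t| * (q ^ 3)⁻¹ := by
  obtain ⟨b1, b2⟩ := add_mul_bounds h0 h ht
  have hd : |q - (q + t * q')| ≤ |t| * (q / 2) := by
    rw [sub_add_cancel_left, abs_neg, abs_mul, abs_of_nonneg h0]
    exact mul_le_mul_of_nonneg_left (by linarith) (abs_nonneg t)
  set Q := q + t * q'
  have hQ : 0 < Q := by linarith
  have hinv : (Q ^ 3)⁻¹ ≤ 8 * (q ^ 3)⁻¹ := by
    have h1 : (q / 2) ^ 3 ≤ Q ^ 3 := by gcongr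
    refine (inv_anti₀ (by positivity) h1).trans_eq ?_
    rw [div_pow, inv_div, div_eq_mul_inv]; norm_num
  refine ⟨hinv, ?_⟩
  have h2 : (Q ^ 3)⁻¹ - (q ^ 3)⁻¹ = (q - Q) * (q ^ 2 + q * Q + Q ^ 2) * (Q ^ 3)⁻¹ * (q ^ 3)⁻¹ := by
    field_simp; ring
  have h3 : q ^ 2 + q * Q + Q ^ 2 ≤ 19 / 4 * q ^ 2 := by nlinarith
  rw [h2, abs_mul, abs_mul, abs_mul, abs_of_pos (by positivity : 0 < q ^ 2 + q * Q + Q ^ 2),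
    abs_of_pos (by positivity : 0 < (Q ^ 3)⁻¹), abs_of_pos (by positivity : 0 < (q ^ 3)⁻¹)]
  refine mul_le_mul_of_nonneg_right ?_ (by positivity)
  calc |q - Q| * (q ^ 2 + q * Q + Q ^ 2) * (Q ^ 3)⁻¹
      ≤ (|t| * (q / 2)) * (19 / 4 * q ^ 2) * (8 * (q ^ 3)⁻¹) := by gcongr
    _ = 19 * |t| := by field_simp; ring

lemma uIoo_zero_subset {s : ℝ} (hs : s ∈ Ioo (-1 : ℝ) 1) {t : ℝ} (ht : t ∈ uIoo 0 s) :
    t ∈ Ioo (-1 : ℝ) 1 ∧ |t| ≤ |s| := by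
  rcases le_total 0 s with h | h
  · rw [uIoo_of_le h] at ht
    refine ⟨⟨by linarith [ht.1], ht.2.trans hs.2⟩, ?_⟩
    rw [abs_of_pos ht.1, abs_of_nonneg h]; exact ht.2.le
  · rw [uIoo_of_ge h] at ht
    refine ⟨⟨hs.1.trans ht.1, by linarith [ht.2]⟩, ?_⟩
    rw [abs_of_neg ht.2, abs_of_nonpos h]; linarith [ht.1]

/-- The Jacobian of the chart is (q + t q')⁻², so Φ(t) enters with weight (q + t q')⁻³, which is
replaced by q⁻³ at relative cost 19|t|. The model error gives 280 = 35 · 8. -/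
lemma LocalModel.abs_lintegral_sub_le {p q p' q' K s : ℝ} (H : LocalModel p q p' q' K)
    (hK : K ≤ 35) (hq : 0 < q) (hs : s ∈ Ioo (-1 : ℝ) 1) (hs0 : s ≠ 0)
    (hx₀ : p / q ∈ Icc (0 : ℝ) 1) (hx : (p + s * p') / (q + s * q') ∈ Icc (0 : ℝ) 1) :
    |(∫⁻ t in uIoo (p / q) ((p + s * p') / (q + s * q')), Phi t).toReal
      - (Phi (p / q)).toReal * |(p + s * p') / (q + s * q') - p / q|
      - (q ^ 3)⁻¹ * (∫⁻ t in uIoo 0 s, Per t).toReal| ≤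
    280 * |s| ^ 2 * (q ^ 3)⁻¹ + 19 * |s| * (q ^ 3)⁻¹ * (∫⁻ t in uIoo 0 s, Per t).toReal := by
  obtain ⟨hq'0, hq'q, hdet, -, hb⟩ := H
  set x₁ := (p + s * p') / (q + s * q') with hx₁
  set g : ℝ → ℝ := fun t => (p + t * p') / (q + t * q') with hg
  set d := p' * q - p * q' with hd
  have hd0 : d ≠ 0 := fun h => by rw [h, abs_zero] at hdet; exact zero_ne_one hdet
  have hQs : 0 < q + s * q' := by linarith [(add_mul_bounds hq'0 hq'q hs).1]
  have hQ : ∀ t ∈ uIoo 0 s, 0 < q + t * q' := fun t ht => by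
    linarith [(add_mul_bounds hq'0 hq'q (uIoo_zero_subset hs ht).1).1]
  have himage : g '' uIoo 0 s = uIoo (p / q) x₁ := by
    have := image_moebius_uIoo (p := p) (p' := p') hq hQs hs0 hd0
    rw [add_sub_cancel] at this
    exact this
  have hderiv : ∀ t ∈ uIoo 0 s, HasDerivWithinAt g (d / (q + t * q') ^ 2) (uIoo 0 s) t := by
    intro t ht
    have h1 : HasDerivAt (fun t : ℝ => p + t * p') p' t := by
      simpa using ((hasDerivAt_id t).mul_const p').const_add p
    have h2 : HasDerivAt (fun t : ℝ => q + t * q') q' t := by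
      simpa using ((hasDerivAt_id t).mul_const q').const_add q
    refine (h1.div h2 (hQ t ht).ne').hasDerivWithinAt.congr_deriv ?_
    congr 1
    rw [hd]; ring
  have hinj : InjOn g (uIoo 0 s) := by
    intro a ha b hb hab
    simp only [hg] at hab
    rw [div_eq_div_iff (hQ a ha).ne' (hQ b hb).ne'] at hab
    have : (a - b) * d = 0 := by rw [hd]; linear_combination hab
    exact sub_eq_zero.1 ((mul_eq_zero.1 this).resolve_right hd0)
  have habsd : ∀ t, |d / (q + t * q') ^ 2| = ((q + t * q') ^ 2)⁻¹ := fun t => by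
    rw [abs_div, hdet, abs_of_nonneg (sq_nonneg _), one_div]
  set F : ℝ → ℝ := fun t => (Per t).toReal with hF
  set Φ₀ := (Phi (p / q)).toReal
  -- integrals over the two intervals
  have hVfin := lintegral_Per_uIoo_ne_top hs
  have hFint : IntegrableOn F (uIoo 0 s) :=
    integrable_toReal_of_lintegral_ne_top measurable_Per.aemeasurable hVfin
  have hVae : ∀ᵐ t ∂volume.restrict (uIoo 0 s), Per t < ∞ := ae_lt_top measurable_Per hVfin
  have hV : ∫ t in uIoo 0 s, F t = (∫⁻ t in uIoo 0 s, Per t).toReal :=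
    integral_toReal measurable_Per.aemeasurable hVae
  have hIeq : ∫⁻ t in uIoo (p / q) x₁, Phi t = ∫⁻ t in uIoo (p / q) x₁, Per t :=
    setLIntegral_congr_fun measurableSet_uIoo
      fun t ht => (Per_eq_Phi (uIoo_subset_Icc hx₀ hx ht)).symm
  have hIfin : ∫⁻ t in uIoo (p / q) x₁, Per t ≠ ∞ := by
    rw [← hIeq]; exact lintegral_Phi_ne_top (uIoo_subset_Icc hx₀ hx)
  have hFint' : IntegrableOn F (uIoo (p / q) x₁) :=
    integrable_toReal_of_lintegral_ne_top measurable_Per.aemeasurable hIfin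
  have hΔ : (∫⁻ t in uIoo (p / q) x₁, Phi t).toReal
      = ∫ t in uIoo 0 s, ((q + t * q') ^ 2)⁻¹ * F (g t) := by
    rw [hIeq, ← integral_toReal measurable_Per.aemeasurable (ae_lt_top measurable_Per hIfin),
      ← himage, integral_image_eq_integral_abs_deriv_smul measurableSet_uIoo hderiv hinj]
    simp only [habsd, smul_eq_mul, hF]
  have hΔint : IntegrableOn (fun t => ((q + t * q') ^ 2)⁻¹ * F (g t)) (uIoo 0 s) := by
    rw [← himage, integrableOn_image_iff_integrableOn_abs_deriv_smul measurableSet_uIoo hderiv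
      hinj] at hFint'
    simpa only [habsd, smul_eq_mul] using hFint'
  have hconst : IntegrableOn (fun _ : ℝ => (1 : ℝ)) (uIoo (p / q) x₁) :=
    integrableOn_const (by rw [Real.volume_uIoo]; exact ENNReal.ofReal_ne_top)
  have hlen : |x₁ - p / q| = ∫ t in uIoo 0 s, ((q + t * q') ^ 2)⁻¹ := by
    have h1 : ∫ _ in uIoo (p / q) x₁, (1 : ℝ) = |x₁ - p / q| := by
      rw [setIntegral_const, smul_eq_mul, mul_one, Measure.real, Real.volume_uIoo,
        ENNReal.toReal_ofReal (abs_nonneg _)]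
    rw [← h1, ← himage, integral_image_eq_integral_abs_deriv_smul measurableSet_uIoo hderiv hinj]
    simp only [habsd, smul_eq_mul, mul_one]
  have hlenint : IntegrableOn (fun t => ((q + t * q') ^ 2)⁻¹) (uIoo 0 s) := by
    rw [← himage, integrableOn_image_iff_integrableOn_abs_deriv_smul measurableSet_uIoo hderiv
      hinj] at hconst
    simpa only [habsd, smul_eq_mul, mul_one] using hconst
  have hcomb : (∫⁻ t in uIoo (p / q) x₁, Phi t).toReal - Φ₀ * |x₁ - p / q|
      - (q ^ 3)⁻¹ * (∫⁻ t in uIoo 0 s, Per t).toReal =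
      ∫ t in uIoo 0 s, (((q + t * q') ^ 2)⁻¹ * F (g t) - Φ₀ * ((q + t * q') ^ 2)⁻¹
        - (q ^ 3)⁻¹ * F t) := by
    have hi : Integrable (fun t => ((q + t * q') ^ 2)⁻¹ * F (g t) - Φ₀ * ((q + t * q') ^ 2)⁻¹)
        (volume.restrict (uIoo 0 s)) := hΔint.sub (hlenint.const_mul Φ₀)
    rw [hΔ, hlen, ← hV, integral_sub hi (hFint.const_mul _),
      integral_sub hΔint (hlenint.const_mul _), integral_const_mul, integral_const_mul]
  have hcJ : Integrable (fun _ : ℝ => 280 * |s| * (q ^ 3)⁻¹) (volume.restrict (uIoo 0 s)) :=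
    integrableOn_const (by rw [Real.volume_uIoo]; exact ENNReal.ofReal_ne_top)
  have hbound : ∫ t in uIoo 0 s, (280 * |s| * (q ^ 3)⁻¹ + 19 * |s| * (q ^ 3)⁻¹ * F t) =
      280 * |s| ^ 2 * (q ^ 3)⁻¹ + 19 * |s| * (q ^ 3)⁻¹ * (∫⁻ t in uIoo 0 s, Per t).toReal := by
    rw [integral_add hcJ (hFint.const_mul _), setIntegral_const, integral_const_mul, hV, smul_eq_mul, Measure.real, Real.volume_uIoo, sub_zero,
      ENNReal.toReal_ofReal (abs_nonneg _)]
    ring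
  rw [hcomb, ← hbound, ← Real.norm_eq_abs]
  refine norm_integral_le_of_norm_le (hcJ.add (hFint.const_mul _)) ?_
  -- The model is valid only where `Per t` is finite, which is almost everywhere by integrability.
  filter_upwards [hVae, ae_restrict_mem measurableSet_uIoo] with t ht htJ
  obtain ⟨ht1, hts⟩ := uIoo_zero_subset hs htJ
  have hbt := hb t ht1 ht.ne
  obtain ⟨c1, c2⟩ := abs_inv_pow_three_sub_le hq hq'0 hq'q ht1
  have hQt := hQ t htJ
  have hFt : 0 ≤ F t := ENNReal.toReal_nonneg
  change |F (g t) - Φ₀ - F t / (q + t * q')| ≤ K * |t| / (q + t * q') at hbt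
  set Q := q + t * q'
  have hsplit : (Q ^ 2)⁻¹ * F (g t) - Φ₀ * (Q ^ 2)⁻¹ - (q ^ 3)⁻¹ * F t
      = (Q ^ 2)⁻¹ * (F (g t) - Φ₀ - F t / Q) + ((Q ^ 3)⁻¹ - (q ^ 3)⁻¹) * F t := by
    field_simp; ring
  rw [hsplit, Real.norm_eq_abs]
  refine (abs_add_le _ _).trans (add_le_add ?_ ?_)
  · rw [abs_mul, abs_of_pos (by positivity)]
    calc (Q ^ 2)⁻¹ * |F (g t) - Φ₀ - F t / Q| ≤ (Q ^ 2)⁻¹ * (35 * |s| / Q) := by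
          refine mul_le_mul_of_nonneg_left (hbt.trans ?_) (by positivity)
          gcongr
      _ = 35 * |s| * (Q ^ 3)⁻¹ := by field_simp
      _ ≤ 35 * |s| * (8 * (q ^ 3)⁻¹) := by gcongr
      _ = 280 * |s| * (q ^ 3)⁻¹ := by ring
  · rw [abs_mul, abs_of_nonneg hFt]
    refine mul_le_mul_of_nonneg_right (c2.trans ?_) hFt
    gcongr

/-- Passing from the coordinate `s` to `θ = q² h`. -/
lemma abs_mul_log_sub_le {ρ s θ : ℝ} (hρ0 : 0 ≤ ρ) (hρ : ρ ≤ 1 / 2) (hs : s ∈ Ioo (-1 : ℝ) 1)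
    (hs0 : s ≠ 0) (hθ : θ = |s| / (1 + ρ * s)) :
    |(|s| * (Real.log (1 / |s|) + 1)) - θ * (Real.log (1 / θ) + 1)| ≤
      3 * |s| ^ 2 * (Real.log (1 / |s|) + 1) ∧
    |s| ≤ 3 / 2 * θ ∧ Real.log (1 / |s|) ≤ Real.log (1 / θ) + 1 := by
  have ha0 : 0 < |s| := abs_pos.2 hs0
  have ha1 : |s| < 1 := abs_lt.2 hs
  have hρs : |ρ * s| ≤ |s| / 2 := by
    rw [abs_mul, abs_of_nonneg hρ0]
    nlinarith
  set u := 1 + ρ * s with hu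
  have hρs' := abs_le.1 hρs
  have hu1 : 1 / 2 ≤ u := by linarith
  have hu2 : u ≤ 3 / 2 := by linarith
  have hu0 : 0 < u := by linarith
  have hθ0 : 0 < θ := by rw [hθ]; positivity
  have hl : 0 ≤ Real.log (1 / |s|) := Real.log_nonneg (by rw [le_div_iff₀ ha0]; linarith)
  have hlogθ : Real.log (1 / θ) = Real.log (1 / |s|) + Real.log u := by
    rw [hθ, one_div_div, ← Real.log_mul (by positivity) hu0.ne']
    congr 1; ring
  have hlu1 : Real.log u ≤ |s| / 2 := by
    have := Real.log_le_sub_one_of_pos hu0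
    linarith
  have hlu2 : -|s| ≤ Real.log u := by
    have h1 := Real.one_sub_inv_le_log_of_pos hu0
    have h2 : 1 - u⁻¹ = (ρ * s) / u := by
      rw [eq_div_iff hu0.ne', sub_mul, inv_mul_cancel₀ hu0.ne', hu]; ring
    have h3 : -|s| ≤ (ρ * s) / u := by
      rw [le_div_iff₀ hu0]
      nlinarith
    linarith
  have haθ : |s| = θ * u := by rw [hθ]; field_simp
  have hθ2 : θ ≤ 2 * |s| := by rw [haθ]; nlinarith
  have hdiff : |(|s| - θ)| ≤ |s| ^ 2 := by
    have : |s| - θ = θ * (ρ * s) := by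
      have : |s| = θ * (1 + ρ * s) := haθ
      rw [mul_add, mul_one] at this; linarith
    rw [this, abs_mul, abs_of_pos hθ0]
    calc θ * |ρ * s| ≤ (2 * |s|) * (|s| / 2) := by gcongr
      _ = |s| ^ 2 := by ring
  refine ⟨?_, ?_, ?_⟩
  · have e : |s| * (Real.log (1 / |s|) + 1) - θ * (Real.log (1 / θ) + 1)
        = (|s| - θ) * (Real.log (1 / |s|) + 1) - θ * Real.log u := by
      rw [hlogθ]; ring
    rw [e]
    have h1 : |(|s| - θ) * (Real.log (1 / |s|) + 1)| ≤ |s| ^ 2 * (Real.log (1 / |s|) + 1) := by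
      rw [abs_mul, abs_of_nonneg (a := _ + _) (by positivity)]
      gcongr
    have h2 : |θ * Real.log u| ≤ 2 * |s| ^ 2 := by
      rw [abs_mul, abs_of_pos hθ0]
      have : |Real.log u| ≤ |s| := abs_le.2 ⟨hlu2, by linarith⟩
      calc θ * |Real.log u| ≤ (2 * |s|) * |s| := by gcongr
        _ = 2 * |s| ^ 2 := by ring
    refine (abs_sub _ _).trans ?_
    have : 0 ≤ |s| ^ 2 * Real.log (1 / |s|) := by positivity
    linarith
  · rw [haθ]; nlinarith
  · rw [hlogθ]; linarith

lemma one_third_le_log {θ : ℝ} (h0 : 0 < θ) (h : θ < 2 / 3) : 1 / 3 ≤ Real.log (1 / θ) := by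
  have := Real.one_sub_inv_le_log_of_pos (x := 1 / θ) (by positivity)
  rw [one_div, inv_inv] at this
  rw [one_div θ]
  linarith

/-- Collecting the error terms. -/
lemma abs_sub_le_of_estimates {a Λ X θ c V Y : ℝ} (ha0 : 0 < a) (ha1 : a < 1) (hΛ0 : 0 ≤ Λ)
    (hc0 : 0 < c) (hX : 1 / 3 ≤ X)
    (key : |Y - c * V| ≤ 280 * a ^ 2 * c + 19 * a * c * V)
    (hnear : |V - a * (Λ + 1)| ≤ 32 * a ^ 2 * (Λ + 1))
    (l1 : |a * (Λ + 1) - θ * (X + 1)| ≤ 3 * a ^ 2 * (Λ + 1))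
    (l2 : a ≤ 3 / 2 * θ) (l3 : Λ ≤ X + 1) :
    |Y - c * (θ * (X + 1))| ≤ 15750 * (c * θ ^ 2 * X) := by
  have hV : V ≤ 33 * (a * (Λ + 1)) := by
    have := (abs_le.1 hnear).2
    have : a ^ 2 * (Λ + 1) ≤ a * (Λ + 1) := by
      refine mul_le_mul_of_nonneg_right ?_ (by linarith)
      rw [sq]; exact mul_le_of_le_one_left ha0.le ha1.le
    linarith
  have hE : 0 ≤ a ^ 2 * Λ := by positivity
  -- The coefficients are 280, 627 = 19 · 33 and 35 = 32 + 3, with sum below 1000.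
  have step : |Y - c * (θ * (X + 1))| ≤ c * (1000 * (a ^ 2 * (Λ + 1))) := by
    have e : Y - c * (θ * (X + 1)) = (Y - c * V)
        + c * ((V - a * (Λ + 1)) + (a * (Λ + 1) - θ * (X + 1))) := by ring
    rw [e]
    refine (abs_add_le _ _).trans ((add_le_add key (le_refl _)).trans ?_)
    rw [abs_mul, abs_of_pos hc0]
    have t1 : |(V - a * (Λ + 1)) + (a * (Λ + 1) - θ * (X + 1))| ≤ 35 * (a ^ 2 * (Λ + 1)) :=
      (abs_add_le _ _).trans (by linarith)
    have t2 : 19 * a * c * V ≤ 19 * a * c * (33 * (a * (Λ + 1))) :=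
      mul_le_mul_of_nonneg_left hV (by positivity)
    have t3 : 280 * a ^ 2 * c + 19 * a * c * (33 * (a * (Λ + 1))) =
        c * (280 * a ^ 2 + 627 * (a ^ 2 * (Λ + 1))) := by ring
    have t4 := mul_le_mul_of_nonneg_left t1 hc0.le
    have t5 : c * (280 * a ^ 2 + 627 * (a ^ 2 * (Λ + 1))) + c * (35 * (a ^ 2 * (Λ + 1)))
        ≤ c * (1000 * (a ^ 2 * (Λ + 1))) := by
      rw [← mul_add]
      exact mul_le_mul_of_nonneg_left (by nlinarith) hc0.le
    linarith
  refine step.trans ?_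
  -- Since X ≥ 1/3, Λ + 1 ≤ X + 2 ≤ 7X. With a ≤ (3/2) θ this gives 15750 = 1000 · (9/4) · 7.
  have f1 : a ^ 2 * (Λ + 1) ≤ (3 / 2 * θ) ^ 2 * (7 * X) :=
    mul_le_mul (pow_le_pow_left₀ ha0.le l2 2) (by linarith) (by linarith) (sq_nonneg _)
  calc c * (1000 * (a ^ 2 * (Λ + 1))) ≤ c * (1000 * ((3 / 2 * θ) ^ 2 * (7 * X))) := by gcongr
    _ = 15750 * (c * θ ^ 2 * X) := by ring

lemma LocalModel.abs_Psi_sub_le {p q p' q' K h : ℝ} (H : LocalModel p q p' q' K)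
    (hK : K ≤ 35) (hq : 0 < q) (hh0 : h ≠ 0) (hh : |h| < 2 / (3 * q ^ 2))
    (hx₀ : p / q ∈ Icc (0 : ℝ) 1) (hx : p / q + h ∈ Icc (0 : ℝ) 1) :
    |Psi (p / q + h) - Psi (p / q)
      - (1 / q * (h * Real.log (1 / |h|))
        + (1 / q - 2 * (Real.log q / q) + (Phi (p / q)).toReal) * h)|
      ≤ 15750 * (q * h ^ 2 * Real.log ((q ^ 2 * |h|)⁻¹)) := by
  have hq'0 := H.nonneg
  have hq'q := H.le
  have hdet := H.det
  set d := p' * q - p * q' with hd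
  have hd2 : d * d = 1 := by rw [← abs_mul_abs_self, hdet, one_mul]
  set ρ := q' / q with hρ
  have hρ0 : 0 ≤ ρ := by positivity
  have hρ1 : ρ ≤ 1 / 2 := by rw [hρ, div_le_iff₀ hq]; linarith
  set η := d * q ^ 2 * h with hη
  set θ := q ^ 2 * |h| with hθ
  have hηθ : |η| = θ := by
    rw [hη, abs_mul, abs_mul, hdet, one_mul, abs_of_pos (by positivity : 0 < q ^ 2)]
  have hθ0 : 0 < θ := by have := abs_pos.2 hh0; positivity
  have hθ1 : θ < 2 / 3 := by
    rw [lt_div_iff₀ (by positivity)] at hh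
    rw [hθ]; linarith
  have hη1 := abs_lt.1 (hηθ ▸ hθ1 : |η| < 2 / 3)
  have hη0 : η ≠ 0 := abs_pos.1 (hηθ ▸ hθ0)
  have hden : 2 / 3 < 1 - ρ * η := by nlinarith
  have hden0 : 0 < 1 - ρ * η := by linarith
  -- The solution of h = s d/(q(q + s q')), by d² = 1. For ρ ≤ 1/2 the condition |η| < 2/3 forces
  -- |s| < 1, which is how the range |h| < 2/(3q²) enters.
  set s := η / (1 - ρ * η) with hs
  have hs0 : s ≠ 0 := div_ne_zero hη0 hden0.ne'
  have hs1 : s ∈ Ioo (-1 : ℝ) 1 := by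
    constructor
    · rw [hs, lt_div_iff₀ hden0]; nlinarith
    · rw [hs, div_lt_iff₀ hden0]; nlinarith
  have h1s : 1 + ρ * s = (1 - ρ * η)⁻¹ := by rw [hs]; field_simp; ring
  have hθs : θ = |s| / (1 + ρ * s) := by
    rw [h1s, hs, abs_div, abs_of_pos hden0, hηθ]; field_simp
  have hqs : q + s * q' = q * (1 + ρ * s) := by rw [hρ]; field_simp
  have hqs0 : 0 < q + s * q' := by rw [hqs, h1s]; positivity
  have hxs : (p + s * p') / (q + s * q') = p / q + h := by
    have h1 : (p + s * p') / (q + s * q') - p / q = s * d / ((q + s * q') * q) := by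
      rw [div_sub_div _ _ hqs0.ne' hq.ne']; congr 1; rw [hd]; ring
    have h2 : s * d / ((q + s * q') * q) = h := by
      rw [hqs, h1s, hs]
      have : ∀ E : ℝ, E ≠ 0 → η / E * d / (q * E⁻¹ * q) = η * d / q ^ 2 := fun E hE => by
        field_simp
      rw [this _ hden0.ne', hη]
      have : d * q ^ 2 * h * d = (d * d) * (q ^ 2 * h) := by ring
      rw [this, hd2, one_mul]; field_simp
    linarith
  have hx' := hx
  rw [← hxs] at hx'
  have key := H.abs_lintegral_sub_le hK hq hs1 hs0 hx₀ hx'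
  rw [hxs, add_sub_cancel_left] at key
  have hnear := abs_lintegral_Per_sub_le hs1 hs0
  obtain ⟨l1, l2, l3⟩ := abs_mul_log_sub_le hρ0 hρ1 hs1 hs0 hθs
  have hX := one_third_le_log hθ0 hθ1
  set V := (∫⁻ t in uIoo 0 s, Per t).toReal
  set Δ := (∫⁻ t in uIoo (p / q) (p / q + h), Phi t).toReal with hΔ
  set Φ₀ := (Phi (p / q)).toReal
  have ha0 : 0 < |s| := abs_pos.2 hs0
  have ha1 : |s| < 1 := abs_lt.2 hs1
  set a := |s|
  set Λ := Real.log (1 / a)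
  set X := Real.log (1 / θ) with hXdef
  have hΛ0 : 0 ≤ Λ := Real.log_nonneg (by rw [le_div_iff₀ ha0]; linarith)
  set c := (q ^ 3)⁻¹ with hc
  have hc0 : 0 < c := by positivity
  have hh0' : 0 < |h| := abs_pos.2 hh0
  -- reduction to `|h|`
  have hPsi : Psi (p / q + h) - Psi (p / q) = h * (Δ / |h|) := by
    rw [hΔ, ← Psi_sub_div hx₀ hx, mul_div_cancel₀ _ hh0]
  have hXlog : X = Real.log (1 / |h|) - 2 * Real.log q := by
    rw [hXdef, hθ, one_div, one_div, Real.log_inv, Real.log_inv, Real.log_mul (by positivity)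
      hh0'.ne', Real.log_pow]
    push_cast; ring
  -- The main term q⁻³ θ (log(1/θ) + 1) with θ = q²|h| produces both (1/q) h log(1/|h|) and the
  -- coefficient 1/q - 2 (log q)/q.
  have hmain : Psi (p / q + h) - Psi (p / q) - (1 / q * (h * Real.log (1 / |h|))
        + (1 / q - 2 * (Real.log q / q) + Φ₀) * h)
      = h / |h| * (Δ - Φ₀ * |h| - c * (θ * (X + 1))) := by
    rw [hPsi, hXlog, hc, hθ]
    field_simp
    ring
  rw [hmain, abs_mul, abs_div, abs_abs, div_self hh0'.ne', one_mul, ← one_div θ, ← hXdef]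
  have f2 : c * θ ^ 2 = q * h ^ 2 := by
    rw [hc, hθ, mul_pow, sq_abs]; field_simp
  rw [← f2]
  exact abs_sub_le_of_estimates ha0 ha1 hΛ0 hc0 hX key hnear l1 l2 l3

end Brjuno

end

theorem mainTheorem2 :
    -- the function `Φ` is integrable on `[0,1]`, so that `Ψ` is a genuine real integral
    (∫⁻ t in Icc (0 : ℝ) 1, Brjuno.Phi t) < ∞ ∧
    -- (i)
    (∀ x₀ ∈ Ioo (0 : ℝ) 1, Irrational x₀ →
      (fun h : ℝ => Brjuno.Psi (x₀ + h) - Brjuno.Psi x₀)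
        =o[𝓝[≠] 0] (fun h : ℝ => h * Real.log (1 / |h|))) ∧
    -- (ii), with limit `+∞` where `Φ x₀ = ∞`
    (∀ x₀ ∈ Ioo (0 : ℝ) 1, Irrational x₀ →
      Tendsto (fun h : ℝ => (((Brjuno.Psi (x₀ + h) - Brjuno.Psi x₀) / h : ℝ) : EReal))
        (𝓝[≠] 0) (𝓝 ((Brjuno.Phi x₀ : ℝ≥0∞) : EReal))) ∧
    -- (iii)
    (∃ C : ℝ, ∀ p q : ℕ, 0 < q → p ≤ q → Nat.Coprime p q →
      ∀ h : ℝ, h ≠ 0 → |h| < 2 / (3 * (q : ℝ) ^ 2) → (p : ℝ) / q + h ∈ Icc (0 : ℝ) 1 →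
        |Brjuno.Psi ((p : ℝ) / q + h) - Brjuno.Psi ((p : ℝ) / q)
          - (1 / (q : ℝ) * (h * Real.log (1 / |h|))
            + (1 / (q : ℝ) - 2 * (Real.log q / q) + (Brjuno.Phi ((p : ℝ) / q)).toReal) * h)|
          ≤ C * ((q : ℝ) * h ^ 2 * Real.log (((q : ℝ) ^ 2 * |h|)⁻¹))) := by
  refine ⟨?_, fun x₀ hx₀ hirr => Brjuno.isLittleO_Psi hx₀ hirr,
    fun x₀ hx₀ hirr => Brjuno.tendsto_mean hx₀ hirr, 15750, ?_⟩
  · exact (Brjuno.lintegral_Phi_ne_top subset_rfl).lt_top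
  · intro p q hq hpq hco h hh0 hh hx
    obtain ⟨p', q', K, H, hK⟩ := Brjuno.exists_localModel p q hq hpq hco
    have hq' : (0 : ℝ) < q := by exact_mod_cast hq
    have hpq' : (p : ℝ) ≤ q := by exact_mod_cast hpq
    exact H.abs_Psi_sub_le hK hq' hh0 hh ⟨by positivity, (div_le_one hq').2 hpq'⟩ hx
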